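/- Let $p$ be a prime. Let $X_0$ be the set of isomorphism classes of finite abelian $p$-groups and $X_1$ the set of isomorphism classes of finitely generated $\mathbb{Z}_p$-modules of rank $1$. For $G\in X_0$ let $d^*(G)\in X_1$ be the middle term $H$ of the extension $0\to\mathbb{Z}_p\to H\to G\to 0$ corresponding to a uniformly random element of the finite group $\mathrm{Ext}(G,\mathbb{Z}_p)$. For $H\in X_1$ let $d(H)\in X_0$ be the quotient of $H$ by the submodule generated by a Haar random element of $H$ (this quotient is almost surely finite). Extend $d$ and $d^*$ linearly to finite signed measures and put $\Delta_0=d\,d^*$, an operator on finite signed measures on $X_0$. Let $\mu_0(G)=c_0/\#\mathrm{Aut}(G)$ with $c_0=\prod_{i\ge1}(1-p^{-i})$ be the Cohen–Lenstra measure. For $F\in X_0$ let $\mathbf{Moment}[F]$ be the measure on $X_0$ with value $\#\mathrm{Sur}(G,F)\,\mu_0(G)$ at $G$, and extend $\mathbf{Moment}$ linearly to finitely supported signed measures on $X_0$, so that $\mathbf{Moment}(\mathbb{1}_F)=\mathbf{Moment}[F]$, where $\mathbb{1}_F$ is the unit point mass at $F$. Write $F'\le F$ if $F$ admits a surjection onto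 $F'$, and $F'<F$ if moreover $F'\not\cong F$. Let $\delta_0$ be the linear operator on finitely supported signed measures on $X_0$ that takes $\mathbb{1}_G$ to the distribution of the kernel of a uniformly random element of $\mathrm{Hom}(G,\mathbb{Q}_p/\mathbb{Z}_p)$. Then for every $F\in X_0$ there is a finitely supported signed measure $$e_F=\mathbb{1}_F+\sum_{F'<F}a_{F'}\mathbb{1}_{F'},\qquad a_{F'}\in\mathbb{R},$$ with $\delta_0e_F=\frac1{|F|}e_F$, such that $$E_F:=\mathbf{Moment}(e_F)=\mathbf{Moment}[F]+\sum_{F'<F}a_{F'}\mathbf{Moment}[F']$$ is a nonzero finite signed measure satisfying $\Delta_0E_F=\frac1{|F|}E_F$ and is square-summable, i.e. $\sum_{G\in X_0}E_F(G)^2/\mu_0(G)<\infty$. Moreover, the family $(E_F)_{F\in X_0}$ is linearly independent over $\mathbb{R}$. -/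

import Mathlib

noncomputable section

/-! ### Isomorphism classes of modules over the `p`-adic integers

A finite abelian `p`-group is the same thing as a `ℤ_[p]`-module with finite underlying set
(the module structure is unique, and additive maps between such modules are linear). -/

/-- Isomorphism of `ℤ_[p]`-modules, on the modules that satisfy a given property. -/
def modIso (p : ℕ) [Fact p.Prime] (P : ModuleCat.{0} ℤ_[p] → Prop) :
    Setoid {M : ModuleCat.{0} ℤ_[p] // P M} where
  r M N := Nonempty (M.1 ≃ₗ[ℤ_[p]] N.1)
  iseqv :=
    { refl := fun M => ⟨LinearEquiv.refl ℤ_[p] M.1⟩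
      symm := fun ⟨e⟩ => ⟨e.symm⟩
      trans := fun ⟨e⟩ ⟨f⟩ => ⟨e.trans f⟩ }

/-- The set `X₀` of isomorphism classes of finite abelian `p`-groups. -/
def X0 (p : ℕ) [Fact p.Prime] : Type 1 :=
  Quotient (modIso p (fun M => Finite M))

/-- The set `X₁` of isomorphism classes of finitely generated `ℤ_[p]`-modules of rank one. -/
def X1 (p : ℕ) [Fact p.Prime] : Type 1 :=
  Quotient (modIso p (fun M => Module.Finite ℤ_[p] M ∧ Module.finrank ℤ_[p] M = 1))

/-- A finite module in the given isomorphism class. -/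
def X0.rep {p : ℕ} [Fact p.Prime] (G : X0 p) : ModuleCat.{0} ℤ_[p] := (Quotient.out G).1

/-- A module in the given isomorphism class. -/
def X1.rep {p : ℕ} [Fact p.Prime] (H : X1 p) : ModuleCat.{0} ℤ_[p] := (Quotient.out H).1

instance {p : ℕ} [Fact p.Prime] (G : X0 p) : Finite G.rep := (Quotient.out G).2

instance {p : ℕ} [Fact p.Prime] (H : X1 p) : Module.Finite ℤ_[p] H.rep := (Quotient.out H).2.1

/-- `|G|`. -/
def X0.order {p : ℕ} [Fact p.Prime] (G : X0 p) : ℕ := Nat.card G.rep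

/-- `#Aut(G)`. -/
def X0.numAut {p : ℕ} [Fact p.Prime] (G : X0 p) : ℕ := Nat.card (G.rep ≃ₗ[ℤ_[p]] G.rep)

/-- `#Sur(G, F)`. -/
def X0.numSur {p : ℕ} [Fact p.Prime] (G F : X0 p) : ℕ :=
  Nat.card {f : G.rep →ₗ[ℤ_[p]] F.rep // Function.Surjective f}

/-- `F' ≤ F` if and only if `F` admits a surjection onto `F'`. -/
instance {p : ℕ} [Fact p.Prime] : LE (X0 p) where
  le F' F := ∃ f : F.rep →ₗ[ℤ_[p]] F'.rep, Function.Surjective f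

/-! ### The operator `d*`: extension by a uniformly random class in `Ext(G, ℤ_p)` -/

/-- An extension `0 → ℤ_p → E → G → 0` of `ℤ_[p]`-modules. -/
structure ZpExtension (p : ℕ) [Fact p.Prime] (G : Type) [AddCommGroup G] [Module ℤ_[p] G] :
    Type 1 where
  E : ModuleCat.{0} ℤ_[p]
  ι : ℤ_[p] →ₗ[ℤ_[p]] E
  π : E →ₗ[ℤ_[p]] G
  injective : Function.Injective ι
  exact : Function.Exact ι π
  surjective : Function.Surjective π

/-- Equivalence of extensions: an isomorphism of the middle terms which is compatible with the
identity maps of `ℤ_p` and of `G`. -/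
instance ZpExtension.setoid (p : ℕ) [Fact p.Prime] (G : Type) [AddCommGroup G]
    [Module ℤ_[p] G] : Setoid (ZpExtension p G) where
  r A B := ∃ e : A.E ≃ₗ[ℤ_[p]] B.E, (∀ x, e (A.ι x) = B.ι x) ∧ ∀ y, B.π (e y) = A.π y
  iseqv :=
    { refl := fun A => ⟨LinearEquiv.refl ℤ_[p] A.E, fun _ => rfl, fun _ => rfl⟩
      symm := fun {A B} ⟨e, h₁, h₂⟩ =>
        ⟨e.symm, fun x => by rw [← h₁, e.symm_apply_apply],
          fun y => by rw [← h₂, e.apply_symm_apply]⟩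
      trans := fun {A B C} ⟨e, h₁, h₂⟩ ⟨f, k₁, k₂⟩ =>
        ⟨e.trans f, fun x => by rw [LinearEquiv.trans_apply, h₁, k₁],
          fun y => by rw [LinearEquiv.trans_apply, k₂, h₂]⟩ }

/-- `Ext(G, ℤ_p)`: the (finite, for finite `G`) set of equivalence classes of extensions. -/
def ExtZp (p : ℕ) [Fact p.Prime] (G : Type) [AddCommGroup G] [Module ℤ_[p] G] : Type 1 :=
  Quotient (ZpExtension.setoid p G)

/-- The probability that the middle term of a uniformly random class in `Ext(G, ℤ_p)` is
isomorphic to `H`. -/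
def probDStar {p : ℕ} [Fact p.Prime] (G : X0 p) (H : X1 p) : ℝ :=
  (Nat.card {ξ : ExtZp p G.rep //
      ∃ A : ZpExtension p G.rep, Quotient.mk _ A = ξ ∧ Nonempty (A.E ≃ₗ[ℤ_[p]] H.rep)} : ℝ) /
    Nat.card (ExtZp p G.rep)

/-- The action of `d*` on (signed) measures. -/
def dStar {p : ℕ} [Fact p.Prime] (ν : X0 p → ℝ) : X1 p → ℝ :=
  fun H => ∑' G : X0 p, ν G * probDStar G H

/-! ### The operator `d`: quotient by a Haar random element -/

/-- A finitely generated `ℤ_[p]`-module is compact in its canonical topology. -/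
theorem compactSpace_moduleTopology (p : ℕ) [Fact p.Prime] (H : Type) [AddCommGroup H]
    [Module ℤ_[p] H] [Module.Finite ℤ_[p] H] :
    @CompactSpace H (moduleTopology ℤ_[p] H) := by
  let _ : TopologicalSpace H := moduleTopology ℤ_[p] H
  have : IsModuleTopology ℤ_[p] H := ⟨rfl⟩
  have : ContinuousAdd H := IsModuleTopology.toContinuousAdd ℤ_[p] H
  obtain ⟨n, f, hf⟩ := Module.Finite.exists_fin' ℤ_[p] H
  exact hf.compactSpace (IsModuleTopology.continuous_of_linearMap f)

/-- The Haar probability measure on a finitely generated `ℤ_[p]`-module with its canonical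
(compact) topology, evaluated on the set `S`. -/
def haarProb (p : ℕ) [Fact p.Prime] (H : Type) [AddCommGroup H] [Module ℤ_[p] H]
    [Module.Finite ℤ_[p] H] (S : Set H) : ℝ :=
  letI : TopologicalSpace H := moduleTopology ℤ_[p] H
  haveI : IsModuleTopology ℤ_[p] H := ⟨rfl⟩
  haveI : IsTopologicalAddGroup H := IsModuleTopology.topologicalAddGroup ℤ_[p] H
  haveI : CompactSpace H := compactSpace_moduleTopology p H
  letI : MeasurableSpace H := borel H
  haveI : BorelSpace H := ⟨rfl⟩
  (MeasureTheory.Measure.addHaarMeasure (⊤ : TopologicalSpace.PositiveCompacts H)).real S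

/-- The probability that the quotient of `H` by (the submodule generated by) a Haar random
element of `H` is isomorphic to `G`. -/
def probD {p : ℕ} [Fact p.Prime] (H : X1 p) (G : X0 p) : ℝ :=
  haarProb p H.rep {h | Nonempty ((H.rep ⧸ Submodule.span ℤ_[p] {h}) ≃ₗ[ℤ_[p]] G.rep)}

/-- The action of `d` on (signed) measures. -/
def dOp {p : ℕ} [Fact p.Prime] (η : X1 p → ℝ) : X0 p → ℝ :=
  fun G => ∑' H : X1 p, η H * probD H G

/-- The Cohen–Lenstra operator `Δ₀ = d d*`, acting on (signed) measures on `X₀`. -/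
def Delta0 {p : ℕ} [Fact p.Prime] (ν : X0 p → ℝ) : X0 p → ℝ := dOp (dStar ν)

/-- `ν` is an eigenfunction of `Δ₀` with eigenvalue `c`. Summability says that `ν` is a finite
signed measure; the sums defining `Δ₀ ν` then converge absolutely, since the coefficients
of `d` and `d*` are probabilities. -/
structure IsEigenfunctionDelta0 {p : ℕ} [Fact p.Prime] (ν : X0 p → ℝ) (c : ℝ) : Prop where
  summable : Summable ν
  ne_zero : ν ≠ 0
  eigen : Delta0 ν = c • ν

/-! ### The Cohen–Lenstra measure and the moment measures -/

/-- The Cohen–Lenstra measure `μ₀(G) = c₀ / #Aut(G)`, where `c₀ = ∏_{i ≥ 1} (1 - p⁻ⁱ)`. -/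
def mu0 {p : ℕ} [Fact p.Prime] (G : X0 p) : ℝ :=
  (∏' i : ℕ, (1 - 1 / (p : ℝ) ^ (i + 1))) / G.numAut

/-- The moment measure `Moment[F](G) = #Sur(G, F) μ₀(G)`. -/
def moment {p : ℕ} [Fact p.Prime] (F : X0 p) : X0 p → ℝ :=
  fun G => (G.numSur F : ℝ) * mu0 G

/-- The linear extension of `F ↦ Moment[F]` to finitely supported signed measures. -/
def Moment (p : ℕ) [Fact p.Prime] : (X0 p →₀ ℝ) →ₗ[ℝ] (X0 p → ℝ) :=
  Finsupp.linearCombination ℝ moment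

/-- Finiteness of the norm `∑ ν(G)² / μ₀(G)`. -/
def SquareSummable {p : ℕ} [Fact p.Prime] (ν : X0 p → ℝ) : Prop :=
  Summable (fun G => ν G ^ 2 / mu0 G)

/-! ### The operator `δ₀`: kernel of a uniformly random character -/

/-- The dual `Hom(G, ℚ_p / ℤ_p)`. -/
abbrev Dual0 {p : ℕ} [Fact p.Prime] (G : X0 p) : Type :=
  G.rep →ₗ[ℤ_[p]] (ℚ_[p] ⧸ LinearMap.range (Algebra.linearMap ℤ_[p] ℚ_[p]))

/-- The probability that the kernel of a uniformly random element of `Hom(G, ℚ_p / ℤ_p)` is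
isomorphic to `K`. -/
def probDelta {p : ℕ} [Fact p.Prime] (G K : X0 p) : ℝ :=
  (Nat.card {φ : Dual0 G // Nonempty (LinearMap.ker φ ≃ₗ[ℤ_[p]] K.rep)} : ℝ) /
    Nat.card (Dual0 G)

/-- The action of `δ₀` on finitely supported signed measures. -/
def delta0 {p : ℕ} [Fact p.Prime] (ν : X0 p →₀ ℝ) : X0 p → ℝ :=
  fun K => ν.sum fun G a => a * probDelta G K

end

/-! The map `Moment` intertwines the two operators: `Delta0 ∘ Moment = Moment ∘ δ₀`
(`Delta0_Moment`). Everything else is triangular linear algebra for `δ₀` and an estimate for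
`Moment`.

Intertwining. The class of a character φ of G in Ext(G, ℤ_p) has middle term ℤ_p × ker φ. Counting
surjections ℤ_p × T → G with cyclic kernel in two ways gives detailed balance μ₀(G) P(d*G = H) =
μ₁(H) P(dH = G) (`mu0_mul_probDStar`). Hence d* Moment[F] is μ₁(H) times the mean of #Sur(dH, F).
This mean is #Sur(H, F)/|F|, since a surjection onto F survives in the quotient exactly when it
kills the random element. Detailed balance again turns d of the result into μ₀(G)/|F| times the mean
of #Sur(d*G, F). By `sum_surCount_prod_ker`, that mean is the sum of #Sur(G, ker ψ) over the
characters ψ of F; the Hom version is a double count using duality, and induction on |F| passes to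
Sur.

Eigenvectors. By duality the kernels of characters of F are quotients of F, and only ψ = 0 has
kernel isomorphic to F. So `δ₀` is triangular for ≤ with diagonal entries 1/|F|. Strictly smaller
classes have strictly larger diagonal entries, so e_F can be solved for. `Moment` is injective
because #Sur(G, F) = 0 when |G| ≤ |F| and G ≠ F; thus independence passes from the e_F to the E_F.

Summability. Since #Sur(G, F)² ≤ #Hom(G, F × F), it suffices to sum #Hom(G, F)/#Aut(G)
(`summable_homWeight`). The total over groups of order pⁿ satisfies a recursion with factor 1/(pⁿ −
1), obtained from the same double count. -/

open Submodule MeasureTheory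

/-- The Prüfer module `ℚ_p / ℤ_p`. -/
abbrev Prufer (p : ℕ) [Fact p.Prime] : Type :=
  ℚ_[p] ⧸ LinearMap.range (Algebra.linearMap ℤ_[p] ℚ_[p])

/-! ### Finite and finitely generated modules over ℤ_p -/

section FiniteModules

variable {p : ℕ} [Fact p.Prime]
variable {M N : Type} [AddCommGroup M] [Module ℤ_[p] M] [AddCommGroup N] [Module ℤ_[p] N]

theorem PadicInt.p_ne_zero : (p : ℤ_[p]) ≠ 0 := PadicInt.prime_p.ne_zero

/-- Every nonzero `p`-adic integer is a unit times a power of `p`. -/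
theorem PadicInt.exists_eq_unit_mul_pow {a : ℤ_[p]} (ha : a ≠ 0) :
    ∃ (u : ℤ_[p]ˣ) (v : ℕ), a = u * (p : ℤ_[p]) ^ v :=
  ⟨_, _, PadicInt.unitCoeff_spec ha⟩

/-- The order of `M` annihilates `M`, and in ℤ_p it is a unit times a power of p. -/
theorem exists_pow_smul_eq_zero (p : ℕ) [Fact p.Prime] (M : Type) [AddCommGroup M]
    [Module ℤ_[p] M] [Finite M] : ∃ k : ℕ, ∀ m : M, (p : ℤ_[p]) ^ k • m = 0 := by
  have h0 : (Nat.card M : ℤ_[p]) ≠ 0 := by exact_mod_cast Nat.card_pos.ne'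
  obtain ⟨u, v, h⟩ := PadicInt.exists_eq_unit_mul_pow h0
  refine ⟨v, fun m => ?_⟩
  have h1 : (Nat.card M : ℤ_[p]) • m = 0 := by
    rw [Nat.cast_smul_eq_nsmul]; exact card_nsmul_eq_zero'
  rw [h, mul_smul] at h1
  exact (smul_eq_zero_iff_eq u).1 h1

theorem exists_card_eq_pow (p : ℕ) [Fact p.Prime] (M : Type) [AddCommGroup M]
    [Module ℤ_[p] M] [Finite M] : ∃ n : ℕ, Nat.card M = p ^ n := by
  have h : IsPGroup p (Multiplicative M) := by
    obtain ⟨k, hk⟩ := exists_pow_smul_eq_zero p M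
    intro m
    refine ⟨k, ?_⟩
    have := hk m.toAdd
    rw [← Nat.cast_pow, Nat.cast_smul_eq_nsmul] at this
    exact congrArg Multiplicative.ofAdd this
  obtain ⟨n, hn⟩ := IsPGroup.iff_card.1 h
  exact ⟨n, hn⟩

/-- An additive isomorphism onto a finite module is linear. -/
noncomputable def AddEquiv.toPadicLinearEquiv [Finite N] (e : M ≃+ N) : M ≃ₗ[ℤ_[p]] N :=
  { e with
    map_smul' := fun a m => by
      obtain ⟨k, hk⟩ := exists_pow_smul_eq_zero p N
      have hk' : ∀ m : M, (p : ℤ_[p]) ^ k • m = 0 := fun m => by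
        apply e.injective
        have := hk (e m)
        rw [← Nat.cast_pow, Nat.cast_smul_eq_nsmul] at this ⊢
        rw [map_nsmul, this, map_zero]
      -- Modulo p^k a p-adic integer is a natural number, so scalars act on both sides through ℕ.
      obtain ⟨c, hc⟩ := Ideal.mem_span_singleton'.1 (PadicInt.appr_spec k a)
      have ha : a = c * (p : ℤ_[p]) ^ k + (a.appr k : ℕ) := by rw [hc]; ring
      change e (a • m) = a • e m
      rw [ha, add_smul, add_smul, mul_smul, mul_smul, hk, hk', smul_zero, smul_zero, zero_add,
        zero_add, Nat.cast_smul_eq_nsmul, Nat.cast_smul_eq_nsmul, map_nsmul] }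

instance finite_linearMap [Module.Finite ℤ_[p] M] [Finite N] : Finite (M →ₗ[ℤ_[p]] N) := by
  obtain ⟨n, f, hf⟩ := Module.Finite.exists_fin' ℤ_[p] M
  refine Finite.of_injective (fun g : M →ₗ[ℤ_[p]] N => fun i : Fin n => g (f (Pi.single i 1)))
    fun g h hgh => ?_
  have : g ∘ₗ f = h ∘ₗ f := LinearMap.pi_ext' fun i => by
    ext
    exact congrFun hgh i
  ext x
  obtain ⟨y, rfl⟩ := hf x
  exact LinearMap.congr_fun this y

instance finite_linearEquiv [Finite M] : Finite (M ≃ₗ[ℤ_[p]] N) :=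
  .of_injective (fun e => (e : M ≃ N)) fun _ _ h => LinearEquiv.toEquiv_injective h

theorem card_quotient_span_pow (k : ℕ) :
    Nat.card (ℤ_[p] ⧸ span ℤ_[p] {(p : ℤ_[p]) ^ k}) = p ^ k := by
  have e : (ℤ_[p] ⧸ Ideal.span {(p : ℤ_[p]) ^ k}) ≃+* ZMod (p ^ k) :=
    (Ideal.quotEquivOfEq (PadicInt.ker_toZModPow k).symm).trans
      (RingHom.quotientKerEquivOfSurjective (ZMod.ringHom_surjective _))
  exact (Nat.card_congr e.toEquiv).trans (Nat.card_zmod _)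

instance finite_quotient_span_pow (k : ℕ) :
    Finite (ℤ_[p] ⧸ span ℤ_[p] {(p : ℤ_[p]) ^ k}) :=
  Nat.finite_of_card_ne_zero (by
    rw [card_quotient_span_pow]; exact pow_ne_zero _ (Fact.out : p.Prime).ne_zero)

theorem span_irreducible_pow {q : ℤ_[p]} (hq : Irreducible q) (e : ℕ) :
    span ℤ_[p] {q ^ e} = span ℤ_[p] {(p : ℤ_[p]) ^ e} :=
  Ideal.span_singleton_eq_span_singleton.2
    ((IsDiscreteValuationRing.associated_of_irreducible _ hq PadicInt.irreducible_p).pow_pow)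

/-- The structure theorem for finitely generated `ℤ_p`-modules. -/
theorem exists_equiv_free_prod_pi (p : ℕ) [Fact p.Prime] (M : Type) [AddCommGroup M]
    [Module ℤ_[p] M] [Module.Finite ℤ_[p] M] :
    ∃ (n : ℕ) (ι : Type) (_ : Fintype ι) (e : ι → ℕ),
      Nonempty (M ≃ₗ[ℤ_[p]] (Fin n → ℤ_[p]) ×
        (∀ i, ℤ_[p] ⧸ span ℤ_[p] {(p : ℤ_[p]) ^ e i})) := by
  obtain ⟨n, ι, _, q, hq, e, ⟨f⟩⟩ := Module.equiv_free_prod_directSum ℤ_[p] M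
  refine ⟨n, ι, ‹_›, e, ⟨f.trans (LinearEquiv.prodCongr
    (Finsupp.linearEquivFunOnFinite _ _ _) ?_)⟩⟩
  exact (DirectSum.linearEquivFunOnFintype ℤ_[p] ι _).trans
    (LinearEquiv.piCongrRight fun i => Submodule.quotEquivOfEq _ _ (span_irreducible_pow (hq i) _))

theorem exists_equiv_pi (p : ℕ) [Fact p.Prime] (M : Type) [AddCommGroup M]
    [Module ℤ_[p] M] [Finite M] :
    ∃ (ι : Type) (_ : Fintype ι) (e : ι → ℕ),
      Nonempty (M ≃ₗ[ℤ_[p]] (∀ i, ℤ_[p] ⧸ span ℤ_[p] {(p : ℤ_[p]) ^ e i})) := by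
  obtain ⟨n, ι, _, e, ⟨f⟩⟩ := exists_equiv_free_prod_pi p M
  have hn : IsEmpty (Fin n) := by
    rw [← not_nonempty_iff]
    rintro ⟨i⟩
    have : Finite ℤ_[p] := by
      refine Finite.of_injective (fun a : ℤ_[p] => f.symm (fun _ => a, 0)) fun a b h => ?_
      exact congrFun (congrArg Prod.fst (f.symm.injective h)) i
    exact not_finite ℤ_[p]
  exact ⟨ι, ‹_›, e, ⟨f.trans LinearEquiv.uniqueProd⟩⟩

end FiniteModules

/-! ### Duality with values in ℚ_p/ℤ_p -/

section Duality

variable {p : ℕ} [Fact p.Prime]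
variable {M N : Type} [AddCommGroup M] [Module ℤ_[p] M] [AddCommGroup N] [Module ℤ_[p] N]

/-- The character `a ↦ a / p ^ k` of `ℤ_p`. -/
noncomputable def divPow (p : ℕ) [Fact p.Prime] (k : ℕ) : ℤ_[p] →ₗ[ℤ_[p]] Prufer p :=
  LinearMap.toSpanSingleton ℤ_[p] _ (Submodule.Quotient.mk (((p : ℚ_[p]) ^ k)⁻¹))

theorem divPow_apply (k : ℕ) (a : ℤ_[p]) :
    divPow p k a = Submodule.Quotient.mk ((a : ℚ_[p]) / (p : ℚ_[p]) ^ k) := by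
  rw [divPow, LinearMap.toSpanSingleton_apply, ← Submodule.Quotient.mk_smul, Algebra.smul_def,
    PadicInt.algebraMap_apply, div_eq_mul_inv]

theorem Padic.p_pow_ne_zero (k : ℕ) : (p : ℚ_[p]) ^ k ≠ 0 :=
  pow_ne_zero _ (by exact_mod_cast (Fact.out : p.Prime).ne_zero)

theorem prufer_mk_eq_zero {q : ℚ_[p]} :
    (Submodule.Quotient.mk q : Prufer p) = 0 ↔ ∃ a : ℤ_[p], (a : ℚ_[p]) = q := by
  rw [Submodule.Quotient.mk_eq_zero]; rfl

theorem divPow_eq_zero {k : ℕ} {a : ℤ_[p]} : divPow p k a = 0 ↔ (p : ℤ_[p]) ^ k ∣ a := by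
  rw [divPow_apply, prufer_mk_eq_zero]
  constructor
  · rintro ⟨b, hb⟩
    refine ⟨b, ?_⟩
    rw [eq_div_iff (Padic.p_pow_ne_zero k)] at hb
    apply Subtype.coe_injective
    push_cast
    rw [← hb]
    ring
  · rintro ⟨b, rfl⟩
    refine ⟨b, ?_⟩
    rw [eq_div_iff (Padic.p_pow_ne_zero k)]
    push_cast
    ring

theorem ker_divPow (k : ℕ) : LinearMap.ker (divPow p k) = span ℤ_[p] {(p : ℤ_[p]) ^ k} := by
  ext a
  rw [LinearMap.mem_ker, divPow_eq_zero]
  exact Ideal.mem_span_singleton.symm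

theorem exists_divPow_eq {k : ℕ} {y : Prufer p} (h : (p : ℤ_[p]) ^ k • y = 0) :
    ∃ a, divPow p k a = y := by
  obtain ⟨q, rfl⟩ := Submodule.Quotient.mk_surjective _ y
  rw [← Submodule.Quotient.mk_smul, prufer_mk_eq_zero] at h
  obtain ⟨a, ha⟩ := h
  refine ⟨a, ?_⟩
  rw [divPow_apply, ha, Algebra.smul_def, PadicInt.algebraMap_apply]
  push_cast
  rw [mul_div_cancel_left₀ _ (Padic.p_pow_ne_zero k)]

/-- Ideals are principal, and the value at a generator `a` can be divided by `a` in ℚ_p. This makes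
characters of submodules extend. -/
theorem prufer_baer : Module.Baer ℤ_[p] (Prufer p) := by
  rintro I g
  obtain ⟨a, rfl⟩ := (IsPrincipalIdealRing.principal I).principal
  by_cases ha : a = 0
  · refine ⟨0, fun x hx => ?_⟩
    subst ha
    have : x = 0 := by simpa using hx
    subst this
    exact (map_zero g).symm
  · have hmem : a ∈ span ℤ_[p] {a} := mem_span_singleton_self a
    obtain ⟨q, hq⟩ := Submodule.Quotient.mk_surjective _ (g ⟨a, hmem⟩)
    have ha' : (a : ℚ_[p]) ≠ 0 := fun h => ha (Subtype.coe_injective h)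
    refine ⟨LinearMap.toSpanSingleton ℤ_[p] _ (Submodule.Quotient.mk (q / a)), fun x hx => ?_⟩
    obtain ⟨c, rfl⟩ := mem_span_singleton.1 hx
    have h1 : g ⟨c • a, hx⟩ = c • g ⟨a, hmem⟩ := by rw [← map_smul]; rfl
    rw [h1, ← hq, LinearMap.toSpanSingleton_apply, ← Submodule.Quotient.mk_smul,
      ← Submodule.Quotient.mk_smul]
    congr 1
    change ((c * a : ℤ_[p]) : ℚ_[p]) * (q / a) = (c : ℚ_[p]) * q
    rw [PadicInt.coe_mul]
    field_simp

/-- Cyclic finite modules are self-dual. -/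
noncomputable def cyclicDualEquiv (k : ℕ) : (ℤ_[p] ⧸ span ℤ_[p] {(p : ℤ_[p]) ^ k}) ≃ₗ[ℤ_[p]]
    ((ℤ_[p] ⧸ span ℤ_[p] {(p : ℤ_[p]) ^ k}) →ₗ[ℤ_[p]] Prufer p) := by
  let γ : (ℤ_[p] ⧸ span ℤ_[p] {(p : ℤ_[p]) ^ k}) →ₗ[ℤ_[p]] Prufer p :=
    (span ℤ_[p] {(p : ℤ_[p]) ^ k}).liftQ (divPow p k) (ker_divPow k).ge
  refine (Submodule.quotEquivOfEq _ _ ?_).trans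
    (LinearMap.quotKerEquivOfSurjective (LinearMap.toSpanSingleton ℤ_[p] _ γ) ?_)
  · refine (ker_divPow k).symm.trans ?_
    ext a
    rw [LinearMap.mem_ker, LinearMap.mem_ker, LinearMap.toSpanSingleton_apply]
    constructor
    · intro h
      ext
      change a • divPow p k 1 = 0
      rw [← map_smul, smul_eq_mul, mul_one, h]
    · intro h
      have : a • divPow p k 1 = 0 := LinearMap.congr_fun h (Submodule.Quotient.mk 1)
      rwa [← map_smul, smul_eq_mul, mul_one] at this
  · intro f
    obtain ⟨a, ha⟩ := exists_divPow_eq (p := p) (k := k) (y := f (Submodule.Quotient.mk 1)) (by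
      rw [← map_smul, ← Submodule.Quotient.mk_smul, smul_eq_mul, mul_one,
        (Submodule.Quotient.mk_eq_zero _).2 (mem_span_singleton_self _), map_zero])
    refine ⟨a, ?_⟩
    ext
    change a • divPow p k 1 = f (Submodule.Quotient.mk 1)
    rw [← map_smul, smul_eq_mul, mul_one, ha]

/-- A finite module is isomorphic to its dual. -/
theorem nonempty_equiv_dual (p : ℕ) [Fact p.Prime] (M : Type) [AddCommGroup M]
    [Module ℤ_[p] M] [Finite M] : Nonempty (M ≃ₗ[ℤ_[p]] (M →ₗ[ℤ_[p]] Prufer p)) := by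
  classical
  obtain ⟨ι, _, e, ⟨f⟩⟩ := exists_equiv_pi p M
  let g : (∀ i, ℤ_[p] ⧸ span ℤ_[p] {(p : ℤ_[p]) ^ e i}) ≃ₗ[ℤ_[p]]
      ((∀ i, ℤ_[p] ⧸ span ℤ_[p] {(p : ℤ_[p]) ^ e i}) →ₗ[ℤ_[p]] Prufer p) :=
    (LinearEquiv.piCongrRight fun i => cyclicDualEquiv (e i)).trans
      (LinearMap.lsum ℤ_[p] (fun i => ℤ_[p] ⧸ span ℤ_[p] {(p : ℤ_[p]) ^ e i}) ℤ_[p])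
  exact ⟨(f.trans g).trans (LinearEquiv.congrLeft (Prufer p) ℤ_[p] f.symm)⟩

instance finite_dual [Finite M] : Finite (M →ₗ[ℤ_[p]] Prufer p) :=
  .of_equiv _ (nonempty_equiv_dual p M).some.toEquiv

theorem card_dual (p : ℕ) [Fact p.Prime] (M : Type) [AddCommGroup M]
    [Module ℤ_[p] M] [Finite M] : Nat.card (M →ₗ[ℤ_[p]] Prufer p) = Nat.card M :=
  (Nat.card_congr (nonempty_equiv_dual p M).some.toEquiv).symm

theorem card_eq_card_ker_mul_card_range {N : Type*} [AddCommGroup N] [Module ℤ_[p] N]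
    (f : M →ₗ[ℤ_[p]] N) :
    Nat.card M = Nat.card (LinearMap.ker f) * Nat.card (LinearMap.range f) := by
  rw [Submodule.card_eq_card_quotient_mul_card (LinearMap.ker f),
    Nat.card_congr f.quotKerEquivRange.toEquiv]

/-- The range of a character of a finite module is cyclic of order a power of `p`. -/
theorem range_eq_of_card {φ : M →ₗ[ℤ_[p]] Prufer p} {v : ℕ}
    (h : Nat.card (LinearMap.range φ) = p ^ v) :
    LinearMap.range φ = LinearMap.range (divPow p v) := by
  have hc : Nat.card (LinearMap.range (divPow p v)) = p ^ v := by
    rw [← Nat.card_congr (divPow p v).quotKerEquivRange.toEquiv, ker_divPow,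
      card_quotient_span_pow]
  -- The range is killed by its order p^v, so it lies in the p^v-torsion, which has the same order.
  have hle : LinearMap.range φ ≤ LinearMap.range (divPow p v) := by
    intro y hy
    apply exists_divPow_eq
    have : Nat.card (LinearMap.range φ) • (⟨y, hy⟩ : LinearMap.range φ) = 0 :=
      card_nsmul_eq_zero'
    rw [h] at this
    rw [← Nat.cast_pow, Nat.cast_smul_eq_nsmul]
    exact congrArg Subtype.val this
  have hfin : Finite (LinearMap.range (divPow p v)) :=
    Nat.finite_of_card_ne_zero (by rw [hc]; exact pow_ne_zero _ (Fact.out : p.Prime).ne_zero)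
  refine SetLike.coe_injective (Set.eq_of_subset_of_ncard_le hle ?_ (Set.toFinite _))
  rw [← Nat.card_coe_set_eq, ← Nat.card_coe_set_eq]
  exact (hc.trans h.symm).le

/-- The submodule generated by a character has the same order as the range of the character. -/
theorem card_span_eq_card_range [Finite M] (φ : M →ₗ[ℤ_[p]] Prufer p) :
    Nat.card (span ℤ_[p] {φ}) = Nat.card (LinearMap.range φ) := by
  have : Finite (LinearMap.range φ) := Set.finite_range φ
  obtain ⟨v, hv⟩ := exists_card_eq_pow p (LinearMap.range φ)
  have hr := range_eq_of_card hv
  obtain ⟨m, hm⟩ : divPow p v 1 ∈ LinearMap.range φ := hr ▸ LinearMap.mem_range_self _ _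
  -- The range is generated by 1/p^v, so a scalar kills φ exactly when it kills 1/p^v.
  have hk : LinearMap.ker (LinearMap.toSpanSingleton ℤ_[p] _ φ) =
      span ℤ_[p] {(p : ℤ_[p]) ^ v} := by
    ext a
    rw [← ker_divPow, LinearMap.mem_ker, LinearMap.mem_ker, LinearMap.toSpanSingleton_apply]
    constructor
    · intro h
      have := LinearMap.congr_fun h m
      rw [LinearMap.smul_apply, hm, ← map_smul, smul_eq_mul, mul_one] at this
      exact this
    · intro h
      ext x
      obtain ⟨b, hb⟩ : φ x ∈ LinearMap.range (divPow p v) := hr ▸ LinearMap.mem_range_self _ _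
      rw [LinearMap.smul_apply, ← hb, ← map_smul, smul_eq_mul, mul_comm, ← smul_eq_mul, map_smul,
        h, smul_zero, LinearMap.zero_apply]
  rw [← LinearMap.range_toSpanSingleton,
    ← Nat.card_congr (LinearMap.quotKerEquivRange _).toEquiv, hk, card_quotient_span_pow, hv]

/-- Characters of a submodule extend. -/
theorem exists_extend_dual (K : Submodule ℤ_[p] M) (ψ : K →ₗ[ℤ_[p]] Prufer p) :
    ∃ φ : M →ₗ[ℤ_[p]] Prufer p, φ ∘ₗ K.subtype = ψ :=
  prufer_baer.extension_property _ K.injective_subtype ψ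

/-- The kernel of a character `φ` is isomorphic to the quotient of the dual by `φ`. -/
theorem nonempty_ker_equiv_dual_quotient [Finite M] (φ : M →ₗ[ℤ_[p]] Prufer p) :
    Nonempty (LinearMap.ker φ ≃ₗ[ℤ_[p]]
      ((M →ₗ[ℤ_[p]] Prufer p) ⧸ span ℤ_[p] {φ})) := by
  let r : (M →ₗ[ℤ_[p]] Prufer p) →ₗ[ℤ_[p]] (LinearMap.ker φ →ₗ[ℤ_[p]] Prufer p) :=
    LinearMap.lcomp ℤ_[p] (Prufer p) (LinearMap.ker φ).subtype
  have hr : Function.Surjective r := exists_extend_dual (LinearMap.ker φ)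
  have hle : span ℤ_[p] {φ} ≤ LinearMap.ker r := by
    rw [span_singleton_le_iff_mem, LinearMap.mem_ker]
    ext x
    exact x.2
  -- The kernel of restriction to ker φ has order |M|/|ker φ| = |range φ|, which is the order of the
  -- span of φ.
  have hk : span ℤ_[p] {φ} = LinearMap.ker r := by
    refine SetLike.coe_injective (Set.eq_of_subset_of_ncard_le hle ?_ (Set.toFinite _))
    rw [← Nat.card_coe_set_eq, ← Nat.card_coe_set_eq]
    change Nat.card (LinearMap.ker r) ≤ Nat.card (span ℤ_[p] {φ})
    rw [card_span_eq_card_range]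
    have h1 := card_eq_card_ker_mul_card_range r
    have h2 := card_eq_card_ker_mul_card_range φ
    rw [LinearMap.range_eq_top.2 hr, Nat.card_congr (Submodule.topEquiv (R := ℤ_[p])).toEquiv,
      card_dual, card_dual] at h1
    rw [h1, mul_comm] at h2
    exact (Nat.eq_of_mul_eq_mul_left Nat.card_pos h2).le
  exact ⟨(nonempty_equiv_dual p (LinearMap.ker φ)).some.trans
    ((Submodule.quotEquivOfEq _ _ hk).trans (r.quotKerEquivOfSurjective hr)).symm⟩

/-- The kernels of the characters of `M` are, up to isomorphism, the quotients of `M` by the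
elements of `M`, with the same multiplicities. -/
theorem exists_equiv_ker_quotient (p : ℕ) [Fact p.Prime] (M : Type) [AddCommGroup M]
    [Module ℤ_[p] M] [Finite M] :
    ∃ θ : M ≃ (M →ₗ[ℤ_[p]] Prufer p), ∀ x : M,
      Nonempty (LinearMap.ker (θ x) ≃ₗ[ℤ_[p]] (M ⧸ span ℤ_[p] {x})) := by
  obtain ⟨θ⟩ := nonempty_equiv_dual p M
  refine ⟨θ.toEquiv, fun x => ?_⟩
  obtain ⟨e⟩ := nonempty_ker_equiv_dual_quotient (θ x)
  exact ⟨e.trans (Submodule.Quotient.equiv _ _ θ (by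
    rw [Submodule.map_span, Set.image_singleton]; rfl)).symm⟩

end Duality

/-! ### Isomorphism classes, splitting off the free part, countability -/

section Classes

variable {p : ℕ} [Fact p.Prime]

/-- The isomorphism class of a finite module. -/
noncomputable def X0.of (p : ℕ) [Fact p.Prime] (M : Type) [AddCommGroup M] [Module ℤ_[p] M] [Finite M] : X0 p :=
  Quotient.mk (modIso p fun M => Finite M) ⟨ModuleCat.of ℤ_[p] M, ‹Finite M›⟩

theorem X0.nonempty_rep_of_equiv (M : Type) [AddCommGroup M] [Module ℤ_[p] M] [Finite M] :
    Nonempty ((X0.of p M).rep ≃ₗ[ℤ_[p]] M) :=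
  Quotient.mk_out (s := modIso p fun M => Finite M) ⟨ModuleCat.of ℤ_[p] M, ‹Finite M›⟩

theorem X0.ext_iff_nonempty {G G' : X0 p} : G = G' ↔ Nonempty (G.rep ≃ₗ[ℤ_[p]] G'.rep) := by
  constructor
  · rintro rfl
    exact ⟨LinearEquiv.refl _ _⟩
  · intro h
    exact (Quotient.out_eq G).symm.trans
      ((Quotient.sound (s := modIso p fun M => Finite M) h).trans (Quotient.out_eq G'))

theorem X0.of_eq_iff {M : Type} [AddCommGroup M] [Module ℤ_[p] M] [Finite M] {G : X0 p} :
    X0.of p M = G ↔ Nonempty (M ≃ₗ[ℤ_[p]] G.rep) := by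
  obtain ⟨e⟩ := X0.nonempty_rep_of_equiv (p := p) M
  rw [X0.ext_iff_nonempty]
  exact ⟨fun ⟨f⟩ => ⟨e.symm.trans f⟩, fun ⟨f⟩ => ⟨e.trans f⟩⟩

/-- The isomorphism class of a finitely generated module of rank one. -/
noncomputable def X1.of (p : ℕ) [Fact p.Prime] (M : Type) [AddCommGroup M] [Module ℤ_[p] M]
    (h : Module.Finite ℤ_[p] M ∧ Module.finrank ℤ_[p] M = 1) : X1 p :=
  Quotient.mk (modIso p fun M => Module.Finite ℤ_[p] M ∧ Module.finrank ℤ_[p] M = 1)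
    ⟨ModuleCat.of ℤ_[p] M, h⟩

theorem X1.nonempty_rep_of_equiv (M : Type) [AddCommGroup M] [Module ℤ_[p] M]
    (h : Module.Finite ℤ_[p] M ∧ Module.finrank ℤ_[p] M = 1) :
    Nonempty ((X1.of p M h).rep ≃ₗ[ℤ_[p]] M) :=
  Quotient.mk_out (s := modIso p fun M => Module.Finite ℤ_[p] M ∧ Module.finrank ℤ_[p] M = 1)
    ⟨ModuleCat.of ℤ_[p] M, h⟩

theorem X1.ext_iff_nonempty {H H' : X1 p} : H = H' ↔ Nonempty (H.rep ≃ₗ[ℤ_[p]] H'.rep) := by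
  constructor
  · rintro rfl
    exact ⟨LinearEquiv.refl _ _⟩
  · intro h
    exact (Quotient.out_eq H).symm.trans
      ((Quotient.sound (s := modIso p
        fun M => Module.Finite ℤ_[p] M ∧ Module.finrank ℤ_[p] M = 1) h).trans (Quotient.out_eq H'))

theorem X1.of_eq_iff {M : Type} [AddCommGroup M] [Module ℤ_[p] M]
    {h : Module.Finite ℤ_[p] M ∧ Module.finrank ℤ_[p] M = 1} {H : X1 p} :
    X1.of p M h = H ↔ Nonempty (M ≃ₗ[ℤ_[p]] H.rep) := by
  obtain ⟨e⟩ := X1.nonempty_rep_of_equiv (p := p) M h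
  rw [X1.ext_iff_nonempty]
  exact ⟨fun ⟨f⟩ => ⟨e.symm.trans f⟩, fun ⟨f⟩ => ⟨e.trans f⟩⟩

theorem rank_one_prod (p : ℕ) [Fact p.Prime] (T : Type) [AddCommGroup T] [Module ℤ_[p] T]
    [Finite T] :
    Module.Finite ℤ_[p] (ℤ_[p] × T) ∧ Module.finrank ℤ_[p] (ℤ_[p] × T) = 1 := by
  refine ⟨inferInstance, ?_⟩
  obtain ⟨k, hk⟩ := exists_pow_smul_eq_zero p T
  have h1 : Module.IsTorsion ℤ_[p] (LinearMap.ker (LinearMap.fst ℤ_[p] ℤ_[p] T)) := by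
    rintro ⟨⟨a, t⟩, ha⟩
    have ha : a = 0 := ha
    subst ha
    refine ⟨⟨(p : ℤ_[p]) ^ k, mem_nonZeroDivisors_of_ne_zero
      (pow_ne_zero _ PadicInt.p_ne_zero)⟩, Subtype.ext (Prod.ext ?_ ?_)⟩
    · exact smul_zero ((p : ℤ_[p]) ^ k)
    · exact hk t
  have h2 := Submodule.finrank_quotient_add_finrank (LinearMap.ker (LinearMap.fst ℤ_[p] ℤ_[p] T))
  rw [(LinearMap.quotKerEquivOfSurjective _ LinearMap.fst_surjective).finrank_eq,
    Module.finrank_self, Module.finrank_eq_zero_iff_isTorsion.2 h1] at h2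
  exact h2.symm

theorem exists_equiv_prod_of_finrank_eq_one (M : Type) [AddCommGroup M] [Module ℤ_[p] M]
    [Module.Finite ℤ_[p] M] (h : Module.finrank ℤ_[p] M = 1) :
    ∃ T : X0 p, Nonempty (M ≃ₗ[ℤ_[p]] ℤ_[p] × T.rep) := by
  obtain ⟨n, ι, _, e, ⟨f⟩⟩ := exists_equiv_free_prod_pi p M
  let T := ∀ i, ℤ_[p] ⧸ span ℤ_[p] {(p : ℤ_[p]) ^ e i}
  have hT : Finite T := Pi.finite
  obtain ⟨g⟩ := X0.nonempty_rep_of_equiv (p := p) T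
  have hn : n = 1 := by
    obtain ⟨k, hk⟩ := exists_pow_smul_eq_zero p T
    have h1 : Module.IsTorsion ℤ_[p] (LinearMap.ker (LinearMap.fst ℤ_[p] (Fin n → ℤ_[p]) T)) := by
      rintro ⟨⟨a, t⟩, ha⟩
      have ha : a = 0 := ha
      subst ha
      refine ⟨⟨(p : ℤ_[p]) ^ k, mem_nonZeroDivisors_of_ne_zero
        (pow_ne_zero _ PadicInt.p_ne_zero)⟩, Subtype.ext (Prod.ext ?_ ?_)⟩
      · exact smul_zero ((p : ℤ_[p]) ^ k)
      · exact hk t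
    have h2 := Submodule.finrank_quotient_add_finrank
      (LinearMap.ker (LinearMap.fst ℤ_[p] (Fin n → ℤ_[p]) T))
    rw [(LinearMap.quotKerEquivOfSurjective _ LinearMap.fst_surjective).finrank_eq,
      Module.finrank_fin_fun, Module.finrank_eq_zero_iff_isTorsion.2 h1, ← f.finrank_eq, h] at h2
    exact h2
  subst hn
  exact ⟨X0.of p T, ⟨f.trans (LinearEquiv.prodCongr (LinearEquiv.funUnique _ _ _) g.symm)⟩⟩

theorem X1.exists_equiv_prod (H : X1 p) :
    ∃ T : X0 p, Nonempty (H.rep ≃ₗ[ℤ_[p]] ℤ_[p] × T.rep) :=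
  exists_equiv_prod_of_finrank_eq_one _ (Quotient.out H).2.2

/-- Cancellation of the free part. -/
theorem nonempty_equiv_of_prod_equiv {S T : Type} [AddCommGroup S] [Module ℤ_[p] S] [Finite S]
    [AddCommGroup T] [Module ℤ_[p] T] [Finite T] (e : (ℤ_[p] × S) ≃ₗ[ℤ_[p]] ℤ_[p] × T) :
    Nonempty (S ≃ₗ[ℤ_[p]] T) := by
  -- Torsion elements have free coordinate 0, so `e` and its inverse restrict to the torsion parts.
  have key : ∀ {S T : Type} [AddCommGroup S] [Module ℤ_[p] S] [Finite S]
      [AddCommGroup T] [Module ℤ_[p] T] [Finite T] (e : (ℤ_[p] × S) ≃ₗ[ℤ_[p]] ℤ_[p] × T)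
      (s : S), (e (0, s)).1 = 0 := by
    intro S T _ _ _ _ _ _ e s
    obtain ⟨k, hk⟩ := exists_pow_smul_eq_zero p S
    have h : (p : ℤ_[p]) ^ k • e (0, s) = 0 := by
      rw [← map_smul, Prod.smul_mk, smul_zero, hk]
      exact map_zero e
    have h' : (p : ℤ_[p]) ^ k * (e (0, s)).1 = 0 := congrArg Prod.fst h
    exact (mul_eq_zero.1 h').resolve_left (pow_ne_zero _ PadicInt.p_ne_zero)
  refine ⟨LinearEquiv.ofLinearMap
    (LinearMap.snd ℤ_[p] _ _ ∘ₗ e.toLinearMap ∘ₗ LinearMap.inr ℤ_[p] _ _)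
    (LinearMap.snd ℤ_[p] _ _ ∘ₗ e.symm.toLinearMap ∘ₗ LinearMap.inr ℤ_[p] _ _) ?_ ?_⟩
  · ext t
    change (e (0, (e.symm (0, t)).2)).2 = t
    have h : (0, (e.symm (0, t)).2) = e.symm (0, t) := Prod.ext (key e.symm t).symm rfl
    rw [h, e.apply_symm_apply]
  · ext s
    change (e.symm (0, (e (0, s)).2)).2 = s
    have h : (0, (e (0, s)).2) = e (0, s) := Prod.ext (key e s).symm rfl
    rw [h, e.symm_apply_apply]

/-- A finite module is determined by its order and its addition table. -/
noncomputable def X0.table (G : X0 p) : Σ n : ℕ, (Fin n → Fin n → Fin n) :=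
  ⟨G.order, fun i j => Finite.equivFin G.rep
    ((Finite.equivFin G.rep).symm i + (Finite.equivFin G.rep).symm j)⟩

/-- Additive isomorphisms of finite modules are automatically linear. This yields countability of
the set of classes and finiteness of each order. -/
theorem X0.table_injective : Function.Injective (X0.table (p := p)) := by
  intro G G' h
  -- The cardinalities are made free variables so that they can be identified by substitution.
  have key : ∀ (n n' : ℕ) (e : G.rep ≃ Fin n) (e' : G'.rep ≃ Fin n'),
      (⟨n, fun i j => e (e.symm i + e.symm j)⟩ : Σ n : ℕ, (Fin n → Fin n → Fin n)) =
        ⟨n', fun i j => e' (e'.symm i + e'.symm j)⟩ → G = G' := by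
    intro n n' e e' h
    obtain ⟨rfl, h⟩ := Sigma.mk.inj_iff.1 h
    have h := eq_of_heq h
    refine X0.ext_iff_nonempty.2 ⟨AddEquiv.toPadicLinearEquiv
      { e.trans e'.symm with
        map_add' := fun x y => ?_ }⟩
    have := congrFun (congrFun h (e x)) (e y)
    simp only [Equiv.symm_apply_apply] at this
    change e'.symm (e (x + y)) = e'.symm (e x) + e'.symm (e y)
    rw [this, Equiv.symm_apply_apply]
  exact key _ _ _ _ h

instance : Countable (X0 p) := X0.table_injective.countable

theorem X0.finite_order_eq (n : ℕ) : {G : X0 p | G.order = n}.Finite := by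
  refine Set.Finite.of_injOn (f := X0.table) (t := Set.range (Sigma.mk n)) ?_
    X0.table_injective.injOn (Set.finite_range _)
  rintro G rfl
  exact ⟨_, rfl⟩

theorem X0.order_pos (G : X0 p) : 0 < G.order := Nat.card_pos

end Classes

/-! ### Ext(G, ℤ_p) as the dual of G, and the middle terms -/

section Extensions

variable {p : ℕ} [Fact p.Prime] {G : Type} [AddCommGroup G] [Module ℤ_[p] G]

/-- The pullback of `ℚ_p → ℚ_p / ℤ_p` along a character. -/
noncomputable def pullback (φ : G →ₗ[ℤ_[p]] Prufer p) : Submodule ℤ_[p] (G × ℚ_[p]) :=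
  LinearMap.eqLocus (φ ∘ₗ LinearMap.fst ℤ_[p] G ℚ_[p])
    ((Submodule.mkQ _) ∘ₗ LinearMap.snd ℤ_[p] G ℚ_[p])

theorem mem_pullback {φ : G →ₗ[ℤ_[p]] Prufer p} {y : G × ℚ_[p]} :
    y ∈ pullback φ ↔ φ y.1 = Submodule.Quotient.mk y.2 := Iff.rfl

/-- The extension of `G` by `ℤ_p` that corresponds to a character. -/
noncomputable def pullbackExtension (φ : G →ₗ[ℤ_[p]] Prufer p) : ZpExtension p G where
  E := ModuleCat.of ℤ_[p] (pullback φ)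
  ι := (LinearMap.inr ℤ_[p] G ℚ_[p] ∘ₗ Algebra.linearMap ℤ_[p] ℚ_[p]).codRestrict (pullback φ)
    fun a => by
      rw [mem_pullback]
      exact (map_zero φ).trans (prufer_mk_eq_zero.2 ⟨a, rfl⟩).symm
  π := LinearMap.fst ℤ_[p] G ℚ_[p] ∘ₗ (pullback φ).subtype
  injective a b h := Subtype.coe_injective (congrArg (fun y : pullback φ => y.1.2) h)
  exact y := by
    constructor
    · intro h
      obtain ⟨⟨g, q⟩, hy⟩ := y
      have h : g = 0 := h
      subst h
      rw [mem_pullback, map_zero] at hy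
      obtain ⟨a, ha⟩ := prufer_mk_eq_zero.1 hy.symm
      exact ⟨a, Subtype.ext (Prod.ext rfl ha)⟩
    · rintro ⟨a, rfl⟩
      rfl
  surjective g := by
    obtain ⟨q, hq⟩ := Submodule.Quotient.mk_surjective _ (φ g)
    exact ⟨⟨(g, q), hq.symm⟩, rfl⟩

variable [Finite G]

/-- The inclusion of `ℤ_p` in `ℚ_p` extends uniquely to the middle term of an extension. -/
theorem ZpExtension.existsUnique_extend (A : ZpExtension p G) :
    ∃! q : A.E →ₗ[ℤ_[p]] ℚ_[p], ∀ a, q (A.ι a) = a := by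
  obtain ⟨k, hk⟩ := exists_pow_smul_eq_zero p G
  -- Multiplication by p^k carries the middle term into ℤ_p, and p^k can be inverted in ℚ_p; this
  -- forces the extension.
  have hmem : ∀ y : A.E, (p : ℤ_[p]) ^ k • y ∈ LinearMap.range A.ι := fun y =>
    (A.exact _).1 (by rw [map_smul, hk])
  refine ⟨((p : ℚ_[p]) ^ k)⁻¹ • (Algebra.linearMap ℤ_[p] ℚ_[p] ∘ₗ
    (LinearEquiv.ofInjective A.ι A.injective).symm.toLinearMap ∘ₗ
      (((p : ℤ_[p]) ^ k • LinearMap.id).codRestrict (LinearMap.range A.ι) hmem)), ?_, ?_⟩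
  · intro a
    have h : (((p : ℤ_[p]) ^ k • LinearMap.id).codRestrict (LinearMap.range A.ι) hmem) (A.ι a) =
        LinearEquiv.ofInjective A.ι A.injective ((p : ℤ_[p]) ^ k • a) :=
      Subtype.ext (map_smul A.ι _ a).symm
    rw [LinearMap.smul_apply, LinearMap.comp_apply, LinearMap.comp_apply, h]
    rw [LinearEquiv.coe_coe, LinearEquiv.symm_apply_apply, Algebra.linearMap_apply,
      PadicInt.algebraMap_apply, smul_eq_mul, smul_eq_mul]
    push_cast
    rw [inv_mul_cancel_left₀ (Padic.p_pow_ne_zero k)]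
  · intro q hq
    ext y
    obtain ⟨a, ha⟩ := hmem y
    have h : (((p : ℤ_[p]) ^ k • LinearMap.id).codRestrict (LinearMap.range A.ι) hmem) y =
        LinearEquiv.ofInjective A.ι A.injective a :=
      Subtype.ext ha.symm
    rw [LinearMap.smul_apply, LinearMap.comp_apply, LinearMap.comp_apply, h]
    rw [LinearEquiv.coe_coe, LinearEquiv.symm_apply_apply, Algebra.linearMap_apply,
      PadicInt.algebraMap_apply, ← hq, ha, map_smul, Algebra.smul_def ((p : ℤ_[p]) ^ k),
      PadicInt.algebraMap_apply, smul_eq_mul]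
    push_cast
    rw [inv_mul_cancel_left₀ (Padic.p_pow_ne_zero k)]

theorem ZpExtension.exists_equiv_pullbackExtension (A : ZpExtension p G) :
    ∃ φ : G →ₗ[ℤ_[p]] Prufer p, A ≈ pullbackExtension φ := by
  obtain ⟨q, hq, -⟩ := A.existsUnique_extend
  have hker : LinearMap.ker A.π ≤ LinearMap.ker (Submodule.mkQ _ ∘ₗ q : A.E →ₗ[ℤ_[p]] Prufer p) := by
    intro y hy
    obtain ⟨a, rfl⟩ := (A.exact y).1 hy
    exact prufer_mk_eq_zero.2 ⟨a, (hq a).symm⟩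
  let φ : G →ₗ[ℤ_[p]] Prufer p := (LinearMap.ker A.π).liftQ _ hker ∘ₗ
    (A.π.quotKerEquivOfSurjective A.surjective).symm.toLinearMap
  have hφ : ∀ y, φ (A.π y) = Submodule.Quotient.mk (q y) := by
    intro y
    have : (A.π.quotKerEquivOfSurjective A.surjective).symm (A.π y) = Submodule.Quotient.mk y := by
      rw [LinearEquiv.symm_apply_eq]; rfl
    change (LinearMap.ker A.π).liftQ _ hker
      ((A.π.quotKerEquivOfSurjective A.surjective).symm (A.π y)) = _
    rw [this]
    rfl
  refine ⟨φ, LinearEquiv.ofBijective ((A.π.prod q).codRestrict (pullback φ) hφ) ⟨?_, ?_⟩, ?_, ?_⟩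
  · rw [← LinearMap.ker_eq_bot, LinearMap.ker_eq_bot']
    intro y hy
    have h1 : A.π y = 0 := congrArg (fun y : pullback φ => y.1.1) hy
    have h2 : q y = 0 := congrArg (fun y : pullback φ => y.1.2) hy
    obtain ⟨a, rfl⟩ := (A.exact y).1 h1
    rw [hq] at h2
    have : a = 0 := Subtype.coe_injective h2
    rw [this, map_zero]
  · rintro ⟨⟨g, r⟩, hy⟩
    obtain ⟨y, rfl⟩ := A.surjective g
    rw [mem_pullback, hφ, ← sub_eq_zero, ← Submodule.Quotient.mk_sub, prufer_mk_eq_zero] at hy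
    obtain ⟨a, ha⟩ := hy
    refine ⟨y - A.ι a, Subtype.ext (Prod.ext ?_ ?_)⟩
    · change A.π (y - A.ι a) = A.π y
      rw [map_sub, (A.exact _).2 ⟨a, rfl⟩, sub_zero]
    · change q (y - A.ι a) = r
      rw [map_sub, hq, ha]
      exact sub_sub_cancel _ _
  · intro a
    exact Subtype.ext (Prod.ext ((A.exact _).2 ⟨a, rfl⟩) (hq a))
  · intro y
    rfl

/-- `Ext(G, ℤ_p)` is the dual of `G`. -/
theorem bijective_pullbackExtension :
    Function.Bijective fun φ : G →ₗ[ℤ_[p]] Prufer p =>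
      (Quotient.mk _ (pullbackExtension φ) : ExtZp p G) := by
  constructor
  · intro φ φ' h
    obtain ⟨e, he, he'⟩ := Quotient.exact h
    let q : (pullbackExtension φ).E →ₗ[ℤ_[p]] ℚ_[p] :=
      LinearMap.snd ℤ_[p] G ℚ_[p] ∘ₗ (pullback φ).subtype
    let q' : (pullbackExtension φ').E →ₗ[ℤ_[p]] ℚ_[p] :=
      LinearMap.snd ℤ_[p] G ℚ_[p] ∘ₗ (pullback φ').subtype
    -- By uniqueness of the extension to ℚ_p, an equivalence preserves both coordinates of the
    -- pullback, hence the character.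
    have hq : q = q' ∘ₗ e.toLinearMap :=
      (pullbackExtension φ).existsUnique_extend.unique (fun a => rfl) fun a =>
        (congrArg q' (he a)).trans rfl
    ext g
    obtain ⟨r, hr⟩ := Submodule.Quotient.mk_surjective _ (φ g)
    let y : (pullbackExtension φ).E := (⟨(g, r), hr.symm⟩ : pullback φ)
    have h1 : (show pullback φ' from e y).1.1 = g := he' y
    have h2 : (show pullback φ' from e y).1.2 = r := (LinearMap.congr_fun hq y).symm
    have h3 := mem_pullback.1 (show pullback φ' from e y).2
    rw [h1, h2] at h3
    rw [← hr, h3]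
  · intro ξ
    induction ξ using Quotient.inductionOn with
    | h A =>
      obtain ⟨φ, hφ⟩ := A.exists_equiv_pullbackExtension
      exact ⟨φ, Quotient.sound (Setoid.symm hφ)⟩

/-- If `g₀` maps to the generator 1/p^v of the range of φ, then (g₀, 1/p^v) spans a free complement
to ker φ × 0 in the pullback. -/
theorem nonempty_pullback_equiv (φ : G →ₗ[ℤ_[p]] Prufer p) :
    Nonempty ((ℤ_[p] × LinearMap.ker φ) ≃ₗ[ℤ_[p]] pullback φ) := by
  have : Finite (LinearMap.range φ) := Set.finite_range φ
  obtain ⟨v, hv⟩ := exists_card_eq_pow p (LinearMap.range φ)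
  have hr := range_eq_of_card hv
  obtain ⟨g₀, hg₀⟩ : divPow p v 1 ∈ LinearMap.range φ := hr ▸ LinearMap.mem_range_self _ _
  have hg : ∀ a, φ (a • g₀) = divPow p v a := fun a => by
    rw [map_smul, hg₀, ← map_smul, smul_eq_mul, mul_one]
  let f : (ℤ_[p] × LinearMap.ker φ) →ₗ[ℤ_[p]] G × ℚ_[p] :=
    ((LinearMap.toSpanSingleton ℤ_[p] G g₀).coprod (LinearMap.ker φ).subtype).prod
      (LinearMap.toSpanSingleton ℤ_[p] ℚ_[p] ((p : ℚ_[p]) ^ v)⁻¹ ∘ₗ LinearMap.fst ℤ_[p] _ _)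
  have hf : ∀ y, f y = (y.1 • g₀ + y.2, (y.1 : ℚ_[p]) / (p : ℚ_[p]) ^ v) := fun y =>
    Prod.ext rfl ((Algebra.smul_def (A := ℚ_[p]) y.1 _).trans (div_eq_mul_inv _ _).symm)
  refine ⟨LinearEquiv.ofBijective (f.codRestrict (pullback φ) fun y => ?_) ⟨?_, ?_⟩⟩
  · rw [mem_pullback, hf, map_add, hg, ← divPow_apply]
    exact (congrArg _ y.2.2).trans (add_zero _)
  · rw [← LinearMap.ker_eq_bot, LinearMap.ker_eq_bot']
    rintro ⟨a, k⟩ hy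
    have h : f (a, k) = 0 := congrArg Subtype.val hy
    rw [hf] at h
    have h2 : (a : ℚ_[p]) / (p : ℚ_[p]) ^ v = 0 := congrArg Prod.snd h
    have ha : a = 0 := Subtype.coe_injective
      ((div_eq_zero_iff.1 h2).resolve_right (Padic.p_pow_ne_zero v))
    have h1 : a • g₀ + (k : G) = 0 := congrArg Prod.fst h
    subst ha
    rw [zero_smul, zero_add] at h1
    exact Prod.ext rfl (Subtype.ext h1)
  · rintro ⟨⟨g, r⟩, hy⟩
    rw [mem_pullback] at hy
    obtain ⟨a, ha⟩ : φ g ∈ LinearMap.range (divPow p v) := hr ▸ LinearMap.mem_range_self _ _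
    rw [← ha, divPow_apply, eq_comm, ← sub_eq_zero, ← Submodule.Quotient.mk_sub,
      prufer_mk_eq_zero] at hy
    obtain ⟨b, hb⟩ := hy
    -- Here r − a/p^v is the integer `b`, so a + p^v b is the free coordinate that gives r exactly.
    refine ⟨(a + (p : ℤ_[p]) ^ v * b, ⟨g - (a + (p : ℤ_[p]) ^ v * b) • g₀, ?_⟩),
      Subtype.ext ((hf _).trans (Prod.ext (add_sub_cancel _ _) ?_))⟩
    · rw [LinearMap.mem_ker, map_sub, hg, ← ha, map_add, divPow_eq_zero.2 (dvd_mul_right _ _),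
        add_zero, sub_self]
    · change ((a + (p : ℤ_[p]) ^ v * b : ℤ_[p]) : ℚ_[p]) / (p : ℚ_[p]) ^ v = r
      push_cast
      rw [hb]
      field_simp [Padic.p_pow_ne_zero (p := p) v]
      ring

end Extensions

/-- Reduces the law of d* to kernels of uniformly random characters. -/
theorem card_dual_prod_equiv_eq_probDStar {p : ℕ} [Fact p.Prime] (G : X0 p) (H : X1 p) :
    probDStar G H = (Nat.card {φ : Dual0 G //
      Nonempty ((ℤ_[p] × LinearMap.ker φ) ≃ₗ[ℤ_[p]] H.rep)} : ℝ) / G.order := by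
  let E : Dual0 G ≃ ExtZp p G.rep := Equiv.ofBijective _ (bijective_pullbackExtension (p := p) (G := G.rep))
  rw [probDStar, ← Nat.card_congr E, card_dual]
  congr 2
  refine (Nat.card_congr (E.subtypeEquiv fun φ => ?_)).symm
  obtain ⟨f⟩ := nonempty_pullback_equiv φ
  constructor
  · rintro ⟨e⟩
    exact ⟨pullbackExtension φ, rfl, ⟨f.symm.trans e⟩⟩
  · rintro ⟨A, hA, ⟨e⟩⟩
    obtain ⟨g, -, -⟩ := Quotient.exact hA
    exact ⟨f.trans (g.symm.trans e)⟩

/-! ### Double count of surjections ℤ_p × T → G with cyclic kernel -/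

section Counting

variable {p : ℕ} [Fact p.Prime]

theorem Nat.card_sigma_const {α : Type*} {β : α → Type*} [Finite α] [∀ a, Finite (β a)] {c : ℕ}
    (h : ∀ a, Nat.card (β a) = c) : Nat.card (Σ a, β a) = Nat.card α * c := by
  have := Fintype.ofFinite α
  rw [Nat.card_sigma, Finset.sum_congr rfl fun a _ => h a, Finset.sum_const, Finset.card_univ,
    Nat.card_eq_fintype_card, smul_eq_mul]

theorem LinearMap.exists_comp_eq_of_ker_le {R A B C : Type*} [Ring R] [AddCommGroup A] [Module R A]
    [AddCommGroup B] [Module R B] [AddCommGroup C] [Module R C] {f : A →ₗ[R] B}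
    (hf : Function.Surjective f) {h : A →ₗ[R] C} (hk : LinearMap.ker f ≤ LinearMap.ker h) :
    ∃ g : B →ₗ[R] C, ∀ x, g (f x) = h x := by
  refine ⟨(LinearMap.ker f).liftQ h hk ∘ₗ (f.quotKerEquivOfSurjective hf).symm.toLinearMap,
    fun x => ?_⟩
  have : (f.quotKerEquivOfSurjective hf).symm (f x) = Submodule.Quotient.mk x := by
    rw [LinearEquiv.symm_apply_eq]; rfl
  change (LinearMap.ker f).liftQ h hk ((f.quotKerEquivOfSurjective hf).symm (f x)) = _
  rw [this]
  rfl

theorem card_range_divPow (v : ℕ) : Nat.card (LinearMap.range (divPow p v)) = p ^ v := by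
  rw [← Nat.card_congr (divPow p v).quotKerEquivRange.toEquiv, ker_divPow, card_quotient_span_pow]

variable {G T : Type} [AddCommGroup G] [Module ℤ_[p] G]
  [AddCommGroup T] [Module ℤ_[p] T]

theorem mem_span_pow_pair {v : ℕ} {b : T} {y : ℤ_[p] × T} :
    y ∈ span ℤ_[p] {((p : ℤ_[p]) ^ v, b)} ↔ ∃ c : ℤ_[p], c * (p : ℤ_[p]) ^ v = y.1 ∧ c • b = y.2 := by
  rw [mem_span_singleton]
  exact exists_congr fun c => Prod.ext_iff

/-- Normalizing the first coordinate to p^v exactly, without a unit, makes the generator unique: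
comparing first coordinates forces the scalar to be 1. -/
theorem span_pow_pair_injective {v : ℕ} {b b' : T}
    (h : span ℤ_[p] {((p : ℤ_[p]) ^ v, b)} = span ℤ_[p] {((p : ℤ_[p]) ^ v, b')}) : b = b' := by
  obtain ⟨c, hc, hc'⟩ := mem_span_pow_pair.1 (h ▸ mem_span_singleton_self ((p : ℤ_[p]) ^ v, b))
  have : c = 1 := mul_right_cancel₀ (pow_ne_zero v PadicInt.p_ne_zero) (hc.trans (one_mul _).symm)
  rw [this, one_smul] at hc'
  exact hc'.symm

/-- The surjections `ℤ_p × T → G` whose kernel is generated by an element `(p ^ v, b)`. -/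
def CyclicKernelSurjection (p : ℕ) [Fact p.Prime] (G T : Type) [AddCommGroup G] [Module ℤ_[p] G]
    [AddCommGroup T] [Module ℤ_[p] T] (v : ℕ) : Type :=
  {f : (ℤ_[p] × T) →ₗ[ℤ_[p]] G // Function.Surjective f ∧
    ∃ b : T, LinearMap.ker f = span ℤ_[p] {((p : ℤ_[p]) ^ v, b)}}

variable [Finite G] [Finite T]

/-- A surjection amounts to its kernel, hence `b`, and an identification of the quotient with G;
these identifications form a torsor under Aut(G). -/
theorem card_cyclicKernelSurjection_eq_mul_card_aut (v : ℕ) :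
    Nat.card (CyclicKernelSurjection p G T v) =
      Nat.card {b : T // Nonempty (((ℤ_[p] × T) ⧸ span ℤ_[p] {((p : ℤ_[p]) ^ v, b)}) ≃ₗ[ℤ_[p]] G)} *
        Nat.card (G ≃ₗ[ℤ_[p]] G) := by
  let B := {b : T // Nonempty (((ℤ_[p] × T) ⧸ span ℤ_[p] {((p : ℤ_[p]) ^ v, b)}) ≃ₗ[ℤ_[p]] G)}
  let F : (Σ b : B, ((ℤ_[p] × T) ⧸ span ℤ_[p] {((p : ℤ_[p]) ^ v, b.1)}) ≃ₗ[ℤ_[p]] G) →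
      CyclicKernelSurjection p G T v := fun x =>
    ⟨x.2.toLinearMap ∘ₗ Submodule.mkQ _, x.2.surjective.comp (Submodule.mkQ_surjective _), x.1.1,
      by rw [LinearEquiv.ker_comp, Submodule.ker_mkQ]⟩
  have hF : Function.Bijective F := by
    constructor
    · rintro ⟨⟨b, hb⟩, e⟩ ⟨⟨b', hb'⟩, e'⟩ h
      have h1 : e.toLinearMap ∘ₗ Submodule.mkQ _ = e'.toLinearMap ∘ₗ Submodule.mkQ _ :=
        congrArg Subtype.val h
      obtain rfl : b = b' := by
        apply span_pow_pair_injective (p := p) (v := v)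
        have := congrArg LinearMap.ker h1
        rwa [LinearEquiv.ker_comp, LinearEquiv.ker_comp, Submodule.ker_mkQ,
          Submodule.ker_mkQ] at this
      congr 1
      ext x
      obtain ⟨y, rfl⟩ := Submodule.mkQ_surjective _ x
      exact LinearMap.congr_fun h1 y
    · rintro ⟨f, hf, b, hb⟩
      let e := (Submodule.quotEquivOfEq _ _ hb.symm).trans (f.quotKerEquivOfSurjective hf)
      exact ⟨⟨⟨b, ⟨e⟩⟩, e⟩, Subtype.ext (LinearMap.ext fun x => rfl)⟩
  have hfin : ∀ b : B, Finite
      (((ℤ_[p] × T) ⧸ span ℤ_[p] {((p : ℤ_[p]) ^ v, b.1)}) ≃ₗ[ℤ_[p]] G) := fun b =>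
    .of_injective (fun e => e.symm) fun e e' h => by
      rw [← e.symm_symm, show e.symm = e'.symm from h, e'.symm_symm]
  rw [← Nat.card_congr (Equiv.ofBijective F hF)]
  refine Nat.card_sigma_const fun b => ?_
  obtain ⟨e⟩ := b.2
  exact Nat.card_congr
    { toFun := fun f => e.symm.trans f
      invFun := fun f => e.trans f
      left_inv := fun f => by ext; simp
      right_inv := fun f => by ext; simp }

/-- A surjection f induces the character f(a, t) ↦ a/p^v of G, whose kernel is the image of T.
Conversely, f is recovered from the character, an isomorphism of T with its kernel (|Aut T| choices)
and a preimage of 1/p^v (a coset of the kernel, so |T| choices). -/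
theorem card_cyclicKernelSurjection_eq_mul_card_dual (v : ℕ) :
    Nat.card (CyclicKernelSurjection p G T v) =
      Nat.card {φ : G →ₗ[ℤ_[p]] Prufer p // Nonempty (LinearMap.ker φ ≃ₗ[ℤ_[p]] T) ∧
        Nat.card (LinearMap.range φ) = p ^ v} *
        (Nat.card (T ≃ₗ[ℤ_[p]] T) * Nat.card T) := by
  let D := {φ : G →ₗ[ℤ_[p]] Prufer p // Nonempty (LinearMap.ker φ ≃ₗ[ℤ_[p]] T) ∧
        Nat.card (LinearMap.range φ) = p ^ v}
  let f : ∀ φ : D, (T ≃ₗ[ℤ_[p]] LinearMap.ker φ.1) × {g : G // φ.1 g = divPow p v 1} →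
      ((ℤ_[p] × T) →ₗ[ℤ_[p]] G) := fun φ x =>
    (LinearMap.toSpanSingleton ℤ_[p] G x.2.1).coprod ((LinearMap.ker φ.1).subtype ∘ₗ x.1.toLinearMap)
  have f_apply : ∀ φ x a t, f φ x (a, t) = a • x.2.1 + (x.1 t : G) := fun φ x a t => rfl
  have hφf : ∀ (φ : D) x (y : ℤ_[p] × T), φ.1 (f φ x y) = divPow p v y.1 := by
    rintro φ x ⟨a, t⟩
    rw [f_apply, map_add, map_smul, x.2.2, ← map_smul, smul_eq_mul, mul_one]
    exact (congrArg _ (x.1 t).2).trans (add_zero _)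
  have hfs : ∀ φ x, Function.Surjective (f φ x) := by
    intro φ x y
    obtain ⟨a, ha⟩ : φ.1 y ∈ LinearMap.range (divPow p v) :=
      range_eq_of_card φ.2.2 ▸ LinearMap.mem_range_self _ _
    have hy : y - a • x.2.1 ∈ LinearMap.ker φ.1 := by
      rw [LinearMap.mem_ker, map_sub, map_smul, x.2.2, ← map_smul, smul_eq_mul, mul_one, ha,
        sub_self]
    refine ⟨(a, x.1.symm ⟨_, hy⟩), ?_⟩
    rw [f_apply, LinearEquiv.apply_symm_apply]
    exact add_sub_cancel _ _
  have hfk : ∀ φ x, ∃ b : T, LinearMap.ker (f φ x) = span ℤ_[p] {((p : ℤ_[p]) ^ v, b)} := by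
    intro φ x
    have hg : (p : ℤ_[p]) ^ v • x.2.1 ∈ LinearMap.ker φ.1 := by
      rw [LinearMap.mem_ker, map_smul, x.2.2, ← map_smul, smul_eq_mul, mul_one, divPow_eq_zero]
    have h0 : (p : ℤ_[p]) ^ v • x.2.1 + (x.1 (-x.1.symm ⟨_, hg⟩) : G) = 0 := by
      rw [map_neg, LinearEquiv.apply_symm_apply]
      exact add_neg_cancel _
    -- The kernel is generated by the relation p^v g + b = 0, where g is the chosen preimage of
    -- 1/p^v.
    refine ⟨-x.1.symm ⟨_, hg⟩, le_antisymm ?_ ?_⟩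
    · rintro ⟨a, t⟩ hy
      have h1 : divPow p v a = 0 := by rw [← hφf φ x (a, t), hy, map_zero]
      obtain ⟨c, rfl⟩ := divPow_eq_zero.1 h1
      refine mem_span_pow_pair.2 ⟨c, mul_comm _ _, ?_⟩
      rw [LinearMap.mem_ker, f_apply, mul_comm, mul_smul, eq_neg_of_add_eq_zero_left h0, smul_neg,
        neg_add_eq_zero, ← Submodule.coe_smul, ← map_smul] at hy
      exact x.1.injective (Subtype.ext hy)
    · rw [span_singleton_le_iff_mem, LinearMap.mem_ker, f_apply, h0]
  let F : (Σ φ : D, (T ≃ₗ[ℤ_[p]] LinearMap.ker φ.1) × {g : G // φ.1 g = divPow p v 1}) →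
      CyclicKernelSurjection p G T v := fun x => ⟨f x.1 x.2, hfs _ _, hfk _ _⟩
  have hF : Function.Bijective F := by
    constructor
    · rintro ⟨φ, x⟩ ⟨φ', x'⟩ h
      have h1 : f φ x = f φ' x' := congrArg Subtype.val h
      obtain rfl : φ = φ' := by
        refine Subtype.ext (LinearMap.ext fun g => ?_)
        obtain ⟨y, rfl⟩ := hfs φ x g
        rw [hφf, h1, hφf]
      congr 1
      refine Prod.ext (LinearEquiv.ext fun t => Subtype.ext ?_) (Subtype.ext ?_)
      · have := LinearMap.congr_fun h1 (0, t)
        rwa [f_apply, f_apply, zero_smul, zero_smul, zero_add, zero_add] at this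
      · have := LinearMap.congr_fun h1 (1, 0)
        rwa [f_apply, f_apply, map_zero, map_zero, one_smul, one_smul, Submodule.coe_zero,
          add_zero, add_zero] at this
    · rintro ⟨h, hs, b, hb⟩
      obtain ⟨φ, hφ⟩ := LinearMap.exists_comp_eq_of_ker_le hs
        (h := divPow p v ∘ₗ LinearMap.fst ℤ_[p] ℤ_[p] T) (by
          rw [hb, span_singleton_le_iff_mem, LinearMap.mem_ker]
          exact divPow_eq_zero.2 dvd_rfl)
      have hi : ∀ t : T, h (0, t) ∈ LinearMap.ker φ := fun t =>
        (hφ _).trans (map_zero (divPow p v))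
      let i : T →ₗ[ℤ_[p]] LinearMap.ker φ := (h ∘ₗ LinearMap.inr ℤ_[p] ℤ_[p] T).codRestrict _ hi
      have hi : Function.Bijective i := by
        constructor
        · rw [← LinearMap.ker_eq_bot, LinearMap.ker_eq_bot']
          intro t ht
          have : ((0 : ℤ_[p]), t) ∈ LinearMap.ker h := congrArg Subtype.val ht
          rw [hb, mem_span_pow_pair] at this
          obtain ⟨c, hc, hc'⟩ := this
          rw [(mul_eq_zero.1 hc).resolve_right (pow_ne_zero _ PadicInt.p_ne_zero), zero_smul] at hc'
          exact hc'.symm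
        · rintro ⟨g, hg⟩
          obtain ⟨⟨a, t⟩, rfl⟩ := hs g
          rw [LinearMap.mem_ker, hφ] at hg
          obtain ⟨c, rfl⟩ := divPow_eq_zero.1 hg
          -- Subtracting c(p^v, b), which lies in the kernel, moves (p^v c, t) into 0 × T.
          refine ⟨t - c • b, Subtype.ext ?_⟩
          change h (0, t - c • b) = h ((p : ℤ_[p]) ^ v * c, t)
          have : h ((p : ℤ_[p]) ^ v * c, c • b) = 0 := by
            rw [← LinearMap.mem_ker, hb]
            exact mem_span_pow_pair.2 ⟨c, mul_comm _ _, rfl⟩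
          rw [← sub_zero (h ((p : ℤ_[p]) ^ v * c, t)), ← this, ← map_sub, Prod.mk_sub_mk, sub_self]
      have hr : LinearMap.range φ = LinearMap.range (divPow p v) := by
        refine le_antisymm ?_ ?_
        · rintro _ ⟨g, rfl⟩
          obtain ⟨y, rfl⟩ := hs g
          exact ⟨y.1, (hφ y).symm⟩
        · rintro _ ⟨a, rfl⟩
          exact ⟨h (a, 0), hφ _⟩
      let e := LinearEquiv.ofBijective i hi
      refine ⟨⟨⟨φ, ⟨e.symm⟩, ?_⟩, e, h (1, 0), hφ _⟩, Subtype.ext (LinearMap.ext ?_)⟩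
      · rw [hr, card_range_divPow]
      · rintro ⟨a, t⟩
        change a • h (1, 0) + h (0, t) = h (a, t)
        rw [← map_smul, ← map_add]
        congr 1
        ext <;> simp
  rw [← Nat.card_congr (Equiv.ofBijective F hF)]
  refine Nat.card_sigma_const fun φ => ?_
  obtain ⟨e⟩ := φ.2.1
  rw [Nat.card_prod]
  congr 1
  · exact Nat.card_congr
      { toFun := fun f => f.trans e
        invFun := fun f => f.trans e.symm
        left_inv := fun f => by ext; simp
        right_inv := fun f => by ext; simp }
  · obtain ⟨g₀, hg₀⟩ : divPow p v 1 ∈ LinearMap.range φ.1 :=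
      range_eq_of_card φ.2.2 ▸ LinearMap.mem_range_self _ _
    rw [← Nat.card_congr e.toEquiv]
    exact Nat.card_congr
      { toFun := fun g => ⟨g.1 - g₀, by rw [LinearMap.mem_ker, map_sub, g.2, hg₀, sub_self]⟩
        invFun := fun k => ⟨k.1 + g₀, by rw [map_add, hg₀, k.2, zero_add]⟩
        left_inv := fun g => Subtype.ext (sub_add_cancel _ _)
        right_inv := fun k => Subtype.ext (add_sub_cancel_right _ _) }

/-- Equates the two counts; the orders of G and T already force the range of the character to have
order p^v. Both detailed balance and the summability estimate rest on this. -/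
theorem card_dual_eq_card_quotient_mul {v : ℕ} (hv : Nat.card G = p ^ v * Nat.card T) :
    Nat.card {φ : G →ₗ[ℤ_[p]] Prufer p // Nonempty (LinearMap.ker φ ≃ₗ[ℤ_[p]] T)} *
        (Nat.card (T ≃ₗ[ℤ_[p]] T) * Nat.card T) =
      Nat.card {b : T // Nonempty (((ℤ_[p] × T) ⧸ span ℤ_[p] {((p : ℤ_[p]) ^ v, b)}) ≃ₗ[ℤ_[p]] G)} *
        Nat.card (G ≃ₗ[ℤ_[p]] G) := by
  have h1 := card_cyclicKernelSurjection_eq_mul_card_aut (p := p) (G := G) (T := T) v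
  rw [card_cyclicKernelSurjection_eq_mul_card_dual] at h1
  rw [← h1]
  congr 1
  refine Nat.card_congr (Equiv.subtypeEquivRight fun φ => (and_iff_left_of_imp ?_).symm)
  rintro ⟨f⟩
  rw [card_eq_card_ker_mul_card_range φ, Nat.card_congr f.toEquiv, mul_comm] at hv
  exact Nat.eq_of_mul_eq_mul_right Nat.card_pos hv

end Counting

/-! ### Haar measure and the law of the quotient by a random element -/

section Haar

variable {p : ℕ} [Fact p.Prime]

/-- Isolates what is used of Haar measure: translation invariance and total mass 1. -/
theorem exists_haarProb_eq (p : ℕ) [Fact p.Prime] (H : Type) [AddCommGroup H] [Module ℤ_[p] H]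
    [Module.Finite ℤ_[p] H] :
    ∃ (_ : TopologicalSpace H) (_ : IsModuleTopology ℤ_[p] H) (_ : IsTopologicalAddGroup H)
      (_ : MeasurableSpace H) (_ : BorelSpace H) (μ : Measure H) (_ : μ.IsAddLeftInvariant)
      (_ : IsProbabilityMeasure μ), ∀ S, haarProb p H S = μ.real S := by
  let _ : TopologicalSpace H := moduleTopology ℤ_[p] H
  have : IsModuleTopology ℤ_[p] H := ⟨rfl⟩
  have : IsTopologicalAddGroup H := IsModuleTopology.topologicalAddGroup ℤ_[p] H
  have : CompactSpace H := compactSpace_moduleTopology p H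
  let _ : MeasurableSpace H := borel H
  have : BorelSpace H := ⟨rfl⟩
  exact ⟨_, ‹_›, ‹_›, _, ‹_›, Measure.addHaarMeasure (⊤ : TopologicalSpace.PositiveCompacts H),
    inferInstance, ⟨Measure.addHaarMeasure_self⟩, fun S => rfl⟩

variable {H : Type} [AddCommGroup H] [Module ℤ_[p] H]

section Topology

variable [TopologicalSpace H] [IsModuleTopology ℤ_[p] H]

/-- Linear maps to finite modules are locally constant. -/
theorem isOpen_preimage_of_finite {M : Type} [AddCommGroup M] [Module ℤ_[p] M] [Finite M]
    (f : H →ₗ[ℤ_[p]] M) (S : Set M) : IsOpen (f ⁻¹' S) := by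
  let _ : TopologicalSpace M := ⊥
  have : DiscreteTopology M := ⟨rfl⟩
  obtain ⟨k, hk⟩ := exists_pow_smul_eq_zero p M
  have hopen : IsOpen {a : ℤ_[p] | (p : ℤ_[p]) ^ k ∣ a} := by
    have : {a : ℤ_[p] | (p : ℤ_[p]) ^ k ∣ a} = {a | ‖a‖ < (p : ℝ) ^ (-(k : ℤ) + 1)} := by
      ext a
      rw [Set.mem_ofPred_eq, Set.mem_ofPred_eq, ← PadicInt.norm_le_pow_iff_norm_lt_pow_add_one,
        PadicInt.norm_le_pow_iff_mem_span_pow, Ideal.mem_span_singleton]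
    rw [this]
    exact isOpen_lt continuous_norm continuous_const
  -- As p^k kills M, the action factors through an open congruence and is continuous for the
  -- discrete topology; linear maps out of the module topology are then continuous.
  have : ContinuousSMul ℤ_[p] M := by
    refine ⟨continuous_iff_continuousAt.2 fun ⟨a, m⟩ => ?_⟩
    refine continuousAt_const.congr (f := fun _ => a • m) ?_
    have h1 : {b : ℤ_[p] | (p : ℤ_[p]) ^ k ∣ b - a} ∈ nhds a :=
      (hopen.preimage (continuous_id.sub continuous_const)).mem_nhds (by simp)
    have h2 : ({m} : Set M) ∈ nhds m := (isOpen_discrete _).mem_nhds rfl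
    filter_upwards [prod_mem_nhds h1 h2]
    rintro ⟨b, n⟩ ⟨⟨c, hc⟩, rfl : n = m⟩
    change a • n = b • n
    rw [eq_comm, ← sub_eq_zero, ← sub_smul, hc, mul_comm, mul_smul, hk, smul_zero]
  exact (isOpen_discrete S).preimage (IsModuleTopology.continuous_of_linearMap f)

variable [IsTopologicalAddGroup H] [MeasurableSpace H] [BorelSpace H] {μ : Measure H}
  [μ.IsAddLeftInvariant] [IsProbabilityMeasure μ]

/-- The image of Haar measure in a finite quotient is the uniform measure. -/
theorem measureReal_preimage_of_finite {M : Type} [AddCommGroup M] [Module ℤ_[p] M] [Finite M]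
    {f : H →ₗ[ℤ_[p]] M} (hf : Function.Surjective f) (S : Set M) :
    μ.real (f ⁻¹' S) = (Nat.card S : ℝ) / Nat.card M := by
  classical
  have := Fintype.ofFinite M
  -- The fibres are translates of one another.
  have hfib : ∀ m, μ.real (f ⁻¹' {m}) = μ.real (f ⁻¹' {0}) := by
    intro m
    obtain ⟨h, rfl⟩ := hf m
    rw [measureReal_def, measureReal_def, ← measure_preimage_add μ h (f ⁻¹' {f h})]
    congr 2
    ext x
    simp
  have hsum : ∀ S : Finset M, μ.real (f ⁻¹' S) = S.card * μ.real (f ⁻¹' {0}) := by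
    intro S
    have : f ⁻¹' S = ⋃ m ∈ S, f ⁻¹' {m} := by ext; simp
    rw [this, measureReal_biUnion_finset, Finset.sum_congr rfl fun m _ => hfib m,
      Finset.sum_const, nsmul_eq_mul]
    · intro m _ n _ hmn
      exact Disjoint.preimage _ (by simpa using hmn)
    · intro m _
      exact (isOpen_preimage_of_finite f _).measurableSet
  have h1 := hsum Finset.univ
  rw [Finset.coe_univ, Set.preimage_univ, probReal_univ, Finset.card_univ,
    ← Nat.card_eq_fintype_card] at h1
  have h2 := hsum S.toFinset
  rw [Set.coe_toFinset, Set.toFinset_card, ← Nat.card_eq_fintype_card] at h2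
  have h3 : (Nat.card M : ℝ) ≠ 0 := by exact_mod_cast Nat.card_pos.ne'
  rw [h2, eq_div_iff h3, mul_assoc, mul_comm (μ.real _), ← h1, mul_one]

end Topology

variable {T : Type} [AddCommGroup T] [Module ℤ_[p] T] (e : H ≃ₗ[ℤ_[p]] ℤ_[p] × T)

/-- Reduction of the free part modulo `p ^ v`. -/
noncomputable def reducePow (v : ℕ) :
    H →ₗ[ℤ_[p]] (ℤ_[p] ⧸ span ℤ_[p] {(p : ℤ_[p]) ^ v}) × T :=
  (LinearMap.prodMap (Submodule.mkQ _) LinearMap.id) ∘ₗ e.toLinearMap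

theorem reducePow_surjective (v : ℕ) : Function.Surjective (reducePow e v) := by
  rintro ⟨x, t⟩
  obtain ⟨a, rfl⟩ := Submodule.mkQ_surjective _ x
  obtain ⟨h, hh⟩ := e.surjective (a, t)
  exact ⟨h, by rw [reducePow, LinearMap.comp_apply, LinearEquiv.coe_coe, hh]; rfl⟩

/-- The elements whose free coordinate is divisible by `p ^ v` and whose torsion coordinate is
in `B`. -/
def boxPow (v : ℕ) (B : Set T) : Set H := {h | (p : ℤ_[p]) ^ v ∣ (e h).1 ∧ (e h).2 ∈ B}

theorem boxPow_eq_preimage (v : ℕ) (B : Set T) : boxPow e v B = reducePow e v ⁻¹' ({0} ×ˢ B) := by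
  ext h
  rw [Set.mem_preimage, Set.mem_prod, Set.mem_singleton_iff]
  refine and_congr ?_ Iff.rfl
  refine Ideal.mem_span_singleton.symm.trans ?_
  exact (Submodule.Quotient.mk_eq_zero _).symm

section Quotient

/-- The elements of `H` whose quotient is isomorphic to `G`. -/
def quotientSet (p : ℕ) [Fact p.Prime] (H G : Type) [AddCommGroup H] [Module ℤ_[p] H]
    [AddCommGroup G] [Module ℤ_[p] G] : Set H :=
  {h | Nonempty ((H ⧸ span ℤ_[p] {h}) ≃ₗ[ℤ_[p]] G)}

theorem nonempty_quotient_equiv {A B : Type} [AddCommGroup A] [Module ℤ_[p] A] [AddCommGroup B]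
    [Module ℤ_[p] B] (e : A ≃ₗ[ℤ_[p]] B) {a : A} {b : B} (u : ℤ_[p]ˣ) (h : e a = u • b) :
    Nonempty ((A ⧸ span ℤ_[p] {a}) ≃ₗ[ℤ_[p]] (B ⧸ span ℤ_[p] {b})) := by
  refine ⟨Submodule.Quotient.equiv _ _ e ?_⟩
  rw [Submodule.map_span, Set.image_singleton]
  change span ℤ_[p] {e a} = _
  rw [h]
  exact Submodule.span_singleton_group_smul_eq ℤ_[p] u b

variable {G : Type} [AddCommGroup G] [Module ℤ_[p] G]

/-- Surjections from the quotient are surjections that vanish at the given element. -/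
theorem card_surjective_quotient {F : Type} [AddCommGroup F] [Module ℤ_[p] F] {h : H}
    (hh : h ∈ quotientSet p H G) :
    Nat.card {f : G →ₗ[ℤ_[p]] F // Function.Surjective f} =
      Nat.card {f : {f : H →ₗ[ℤ_[p]] F // Function.Surjective f} // f.1 h = 0} := by
  obtain ⟨e⟩ := hh
  let q : H →ₗ[ℤ_[p]] G := e.toLinearMap ∘ₗ Submodule.mkQ _
  have hq : Function.Surjective q := e.surjective.comp (Submodule.mkQ_surjective _)
  have hk : LinearMap.ker q = span ℤ_[p] {h} := by
    rw [LinearEquiv.ker_comp, Submodule.ker_mkQ]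
  have hqh : q h = 0 := by
    rw [← LinearMap.mem_ker, hk]; exact mem_span_singleton_self h
  refine Nat.card_congr (Equiv.ofBijective
    (fun f => ⟨⟨f.1 ∘ₗ q, f.2.comp hq⟩, (congrArg f.1 hqh).trans (map_zero _)⟩) ⟨?_, ?_⟩)
  · intro f g hfg
    have h1 : f.1 ∘ₗ q = g.1 ∘ₗ q := congrArg (fun x => x.1.1) hfg
    exact Subtype.ext ((LinearMap.cancel_right hq).1 h1)
  · rintro ⟨⟨f, hf⟩, hf0⟩
    obtain ⟨g, hg⟩ := LinearMap.exists_comp_eq_of_ker_le hq (h := f) (by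
      rw [hk, span_singleton_le_iff_mem]; exact hf0)
    refine ⟨⟨g, ?_⟩, Subtype.ext (Subtype.ext (LinearMap.ext hg))⟩
    intro y
    obtain ⟨x, rfl⟩ := hf y
    exact ⟨q x, hg x⟩

/-- The automorphism id × u of ℤ_p × T sends (u p^v, b) to u(p^v, b), so the unit can be dropped
without changing the torsion coordinate. -/
theorem mem_quotientSet_iff {h : H} {v : ℕ} {u : ℤ_[p]ˣ} (hu : (e h).1 = u * (p : ℤ_[p]) ^ v) :
    h ∈ quotientSet p H G ↔
      Nonempty (((ℤ_[p] × T) ⧸ span ℤ_[p] {((p : ℤ_[p]) ^ v, (e h).2)}) ≃ₗ[ℤ_[p]] G) := by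
  let s : (ℤ_[p] × T) ≃ₗ[ℤ_[p]] ℤ_[p] × T :=
    LinearEquiv.prodCongr (LinearEquiv.refl _ _) (LinearEquiv.smulOfUnit u)
  obtain ⟨f⟩ := nonempty_quotient_equiv (e.trans s) (a := h) (b := ((p : ℤ_[p]) ^ v, (e h).2)) u
    (by
      refine Prod.ext ?_ ?_
      · exact hu
      · rfl)
  exact ⟨fun ⟨g⟩ => ⟨f.symm.trans g⟩, fun ⟨g⟩ => ⟨f.trans g⟩⟩

/-- Otherwise no p^k(1, 0) would be a multiple of `h`, and the quotient would be infinite. -/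
theorem fst_ne_zero_of_mem_quotientSet [Finite G] {h : H} (hh : h ∈ quotientSet p H G) : (e h).1 ≠ 0 := by
  intro h0
  obtain ⟨f⟩ := hh
  obtain ⟨k, hk⟩ := exists_pow_smul_eq_zero p G
  have h1 : (p : ℤ_[p]) ^ k • (Submodule.Quotient.mk (e.symm (1, 0)) : H ⧸ span ℤ_[p] {h}) = 0 := by
    apply f.injective
    rw [map_smul, hk, map_zero]
  rw [← Submodule.Quotient.mk_smul, Submodule.Quotient.mk_eq_zero, mem_span_singleton] at h1
  obtain ⟨c, hc⟩ := h1
  have h2 := congrArg (fun x => (e x).1) hc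
  simp only [map_smul, LinearEquiv.apply_symm_apply, Prod.smul_fst, h0, smul_eq_mul,
    mul_one, mul_zero] at h2
  exact pow_ne_zero _ PadicInt.p_ne_zero h2.symm

end Quotient

variable [Finite T]

theorem isOpen_boxPow [TopologicalSpace H] [IsModuleTopology ℤ_[p] H] (v : ℕ) (B : Set T) :
    IsOpen (boxPow e v B) := by
  rw [boxPow_eq_preimage]
  exact isOpen_preimage_of_finite _ _

theorem isOpen_boxPow_diff [TopologicalSpace H] [IsModuleTopology ℤ_[p] H] (v : ℕ) (B : Set T) :
    IsOpen (boxPow e v B \ boxPow e (v + 1) B) := by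
  have : boxPow e v B \ boxPow e (v + 1) B =
      boxPow e v B ∩ (reducePow e (v + 1) ⁻¹' ({0} ×ˢ B)ᶜ) := by
    rw [boxPow_eq_preimage e (v + 1)]; rfl
  rw [this]
  exact (isOpen_boxPow e v B).inter (isOpen_preimage_of_finite _ _)

section Measure

variable [TopologicalSpace H] [IsModuleTopology ℤ_[p] H]
  [IsTopologicalAddGroup H] [MeasurableSpace H] [BorelSpace H] {μ : Measure H}
  [μ.IsAddLeftInvariant] [IsProbabilityMeasure μ]

theorem measureReal_boxPow (v : ℕ) (B : Set T) :
    μ.real (boxPow e v B) = (Nat.card B : ℝ) / (p ^ v * Nat.card T) := by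
  rw [boxPow_eq_preimage, measureReal_preimage_of_finite (reducePow_surjective e v), Nat.card_prod,
    card_quotient_span_pow, Nat.card_congr (Equiv.Set.prod _ _), Nat.card_prod]
  simp

theorem measureReal_boxPow_diff (v : ℕ) (B : Set T) :
    μ.real (boxPow e v B \ boxPow e (v + 1) B) =
      (Nat.card B : ℝ) * (1 - 1 / p) / (p ^ v * Nat.card T) := by
  have hsub : boxPow e (v + 1) B ⊆ boxPow e v B := fun h hh =>
    ⟨(pow_dvd_pow _ v.le_succ).trans hh.1, hh.2⟩
  have hp : (p : ℝ) ≠ 0 := by exact_mod_cast (Fact.out : p.Prime).ne_zero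
  have hT : (Nat.card T : ℝ) ≠ 0 := by exact_mod_cast Nat.card_pos.ne'
  rw [measureReal_sdiff hsub (isOpen_boxPow e _ _).measurableSet, measureReal_boxPow,
    measureReal_boxPow, pow_succ]
  field_simp

end Measure

section Quotient

theorem finite_quotient_of_ne_zero {a : ℤ_[p]} (ha : a ≠ 0) (b : T) :
    Finite ((ℤ_[p] × T) ⧸ span ℤ_[p] {(a, b)}) := by
  obtain ⟨u, v, rfl⟩ := PadicInt.exists_eq_unit_mul_pow ha
  obtain ⟨k, hk⟩ := exists_pow_smul_eq_zero p T
  set N := span ℤ_[p] {((u : ℤ_[p]) * (p : ℤ_[p]) ^ v, b)}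
  let f : (ℤ_[p] ⧸ span ℤ_[p] {(p : ℤ_[p]) ^ (v + k)}) →ₗ[ℤ_[p]] (ℤ_[p] × T) ⧸ N :=
    (span ℤ_[p] {(p : ℤ_[p]) ^ (v + k)}).liftQ (N.mkQ ∘ₗ LinearMap.inl ℤ_[p] ℤ_[p] T) (by
      rw [span_singleton_le_iff_mem, LinearMap.mem_ker]
      refine (Submodule.Quotient.mk_eq_zero _).2 (mem_span_singleton.2
        -- This multiple of (u p^v, b) is (p^(v+k), 0), because p^k kills T; so the quotient is an
        -- image of ℤ/p^(v+k) × T.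
        ⟨(u⁻¹ : ℤ_[p]ˣ) * (p : ℤ_[p]) ^ k, Prod.ext ?_ ?_⟩)
      · change ((u⁻¹ : ℤ_[p]ˣ) * (p : ℤ_[p]) ^ k) * (u * (p : ℤ_[p]) ^ v) = (p : ℤ_[p]) ^ (v + k)
        calc _ = ((u⁻¹ : ℤ_[p]ˣ) * (u : ℤ_[p])) * (p : ℤ_[p]) ^ (v + k) := by ring
          _ = _ := by rw [Units.inv_mul, one_mul]
      · change ((u⁻¹ : ℤ_[p]ˣ) * (p : ℤ_[p]) ^ k) • b = 0
        rw [mul_smul, hk, smul_zero])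
  refine Finite.of_surjective (f.coprod (N.mkQ ∘ₗ LinearMap.inr ℤ_[p] ℤ_[p] T)) ?_
  intro x
  obtain ⟨⟨a, t⟩, rfl⟩ := Submodule.mkQ_surjective _ x
  refine ⟨(Submodule.Quotient.mk a, t), ?_⟩
  change N.mkQ (a, 0) + N.mkQ (0, t) = _
  rw [← map_add]
  simp

variable {G : Type} [AddCommGroup G] [Module ℤ_[p] G] [Finite G]

/-- By the double count, such a `b` produces a character of G with kernel T and range of order p^v.
-/
theorem card_eq_of_quotient_equiv {v : ℕ} {b : T}
    (h : Nonempty (((ℤ_[p] × T) ⧸ span ℤ_[p] {((p : ℤ_[p]) ^ v, b)}) ≃ₗ[ℤ_[p]] G)) :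
    Nat.card G = p ^ v * Nat.card T := by
  have h1 := card_cyclicKernelSurjection_eq_mul_card_aut (p := p) (G := G) (T := T) v
  rw [card_cyclicKernelSurjection_eq_mul_card_dual] at h1
  have : Nonempty {b : T //
    Nonempty (((ℤ_[p] × T) ⧸ span ℤ_[p] {((p : ℤ_[p]) ^ v, b)}) ≃ₗ[ℤ_[p]] G)} := ⟨⟨b, h⟩⟩
  have h2 := (Nat.mul_pos (Nat.card_pos (α := {b : T //
    Nonempty (((ℤ_[p] × T) ⧸ span ℤ_[p] {((p : ℤ_[p]) ^ v, b)}) ≃ₗ[ℤ_[p]] G)}))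
    (Nat.card_pos (α := G ≃ₗ[ℤ_[p]] G))).ne'
  rw [← h1] at h2
  obtain ⟨⟨⟨φ, ⟨f⟩, hv⟩⟩, -⟩ := Nat.card_ne_zero.1 (left_ne_zero_of_mul h2)
  rw [card_eq_card_ker_mul_card_range φ, hv, Nat.card_congr f.toEquiv, mul_comm]

/-- The order of G pins the valuation of the free coordinate to `v`, and a difference of consecutive
boxes selects that valuation. -/
theorem quotientSet_eq_boxPow_diff {v : ℕ} (hG : Nat.card G = p ^ v * Nat.card T) :
    quotientSet p H G = boxPow e v {b | Nonempty
        (((ℤ_[p] × T) ⧸ span ℤ_[p] {((p : ℤ_[p]) ^ v, b)}) ≃ₗ[ℤ_[p]] G)} \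
      boxPow e (v + 1) {b | Nonempty
        (((ℤ_[p] × T) ⧸ span ℤ_[p] {((p : ℤ_[p]) ^ v, b)}) ≃ₗ[ℤ_[p]] G)} := by
  have hinj : ∀ w, Nat.card G = p ^ w * Nat.card T → w = v := fun w hw =>
    Nat.pow_right_injective (Fact.out : p.Prime).two_le
      (Nat.eq_of_mul_eq_mul_right Nat.card_pos (hw.symm.trans hG))
  ext h
  constructor
  · intro hh
    obtain ⟨u, w, huw⟩ := PadicInt.exists_eq_unit_mul_pow (fst_ne_zero_of_mem_quotientSet e hh)
    have h1 := (mem_quotientSet_iff e huw).1 hh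
    obtain rfl := hinj w (card_eq_of_quotient_equiv h1)
    refine ⟨⟨huw ▸ dvd_mul_left _ _, h1⟩, fun h2 => ?_⟩
    have h3 := h2.1
    rw [huw, Units.dvd_mul_left] at h3
    have := (pow_dvd_pow_iff PadicInt.p_ne_zero PadicInt.prime_p.not_isUnit).1 h3
    omega
  · rintro ⟨⟨h1, h2⟩, h3⟩
    have h0 : (e h).1 ≠ 0 := fun h0 => h3 ⟨h0 ▸ dvd_zero _, h2⟩
    obtain ⟨u, w, huw⟩ := PadicInt.exists_eq_unit_mul_pow h0
    have hvw : v ≤ w := by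
      rw [huw, Units.dvd_mul_left] at h1
      exact (pow_dvd_pow_iff PadicInt.p_ne_zero PadicInt.prime_p.not_isUnit).1 h1
    have hwv : ¬ v + 1 ≤ w := fun hw => h3 ⟨huw ▸ (pow_dvd_pow _ hw).mul_left _, h2⟩
    obtain rfl : w = v := by omega
    exact (mem_quotientSet_iff e huw).2 h2

theorem quotientSet_eq_empty (e : H ≃ₗ[ℤ_[p]] ℤ_[p] × T) (hG : ∀ v, Nat.card G ≠ p ^ v * Nat.card T) :
    quotientSet p H G = ∅ := by
  refine Set.eq_empty_of_forall_notMem fun h hh => ?_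
  obtain ⟨u, w, huw⟩ := PadicInt.exists_eq_unit_mul_pow (fst_ne_zero_of_mem_quotientSet e hh)
  exact hG w (card_eq_of_quotient_equiv ((mem_quotientSet_iff e huw).1 hh))

theorem isOpen_quotientSet (e : H ≃ₗ[ℤ_[p]] ℤ_[p] × T) [TopologicalSpace H] [IsModuleTopology ℤ_[p] H] :
    IsOpen (quotientSet p H G) := by
  by_cases hG : ∃ v, Nat.card G = p ^ v * Nat.card T
  · obtain ⟨v, hv⟩ := hG
    rw [quotientSet_eq_boxPow_diff e hv]
    exact isOpen_boxPow_diff _ _ _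
  · rw [quotientSet_eq_empty e (not_exists.1 hG)]
    exact isOpen_empty

variable [TopologicalSpace H] [IsModuleTopology ℤ_[p] H]
  [IsTopologicalAddGroup H] [MeasurableSpace H] [BorelSpace H] {μ : Measure H}
  [μ.IsAddLeftInvariant] [IsProbabilityMeasure μ]

/-- The box measure, rewritten in terms of characters by the double count so as to match d*. If
|G|/|T| is not a power of p, both sides vanish. -/
theorem measureReal_quotientSet (e : H ≃ₗ[ℤ_[p]] ℤ_[p] × T) :
    μ.real (quotientSet p H G) = (1 - 1 / p) / Nat.card G *
      (Nat.card {φ : G →ₗ[ℤ_[p]] Prufer p // Nonempty (LinearMap.ker φ ≃ₗ[ℤ_[p]] T)} *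
        (Nat.card (T ≃ₗ[ℤ_[p]] T) * Nat.card T) / Nat.card (G ≃ₗ[ℤ_[p]] G)) := by
  by_cases hG : ∃ v, Nat.card G = p ^ v * Nat.card T
  · obtain ⟨v, hv⟩ := hG
    have h1 := card_dual_eq_card_quotient_mul hv
    rw [quotientSet_eq_boxPow_diff e hv, measureReal_boxPow_diff]
    have hA : (Nat.card (G ≃ₗ[ℤ_[p]] G) : ℝ) ≠ 0 := by exact_mod_cast Nat.card_pos.ne'
    have h3 := congrArg (Nat.cast (R := ℝ)) h1
    push_cast at h3
    rw [h3, mul_div_cancel_right₀ _ hA, hv]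
    push_cast
    rw [mul_comm (_ / _), mul_div_assoc]
    rfl
  · rw [quotientSet_eq_empty e (not_exists.1 hG), measureReal_empty]
    have : IsEmpty {φ : G →ₗ[ℤ_[p]] Prufer p // Nonempty (LinearMap.ker φ ≃ₗ[ℤ_[p]] T)} := by
      refine ⟨fun ⟨φ, ⟨f⟩⟩ => hG ?_⟩
      have : Finite (LinearMap.range φ) := Set.finite_range φ
      obtain ⟨v, hv⟩ := exists_card_eq_pow p (LinearMap.range φ)
      exact ⟨v, by rw [card_eq_card_ker_mul_card_range φ, hv, Nat.card_congr f.toEquiv, mul_comm]⟩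
    rw [@Nat.card_of_isEmpty _ this]
    simp

/-- Exceptional elements have free coordinate 0, so they lie in every box; the box at `v` has
measure p^(−v). -/
theorem measure_iUnion_quotientSet_compl (e : H ≃ₗ[ℤ_[p]] ℤ_[p] × T) :
    μ (⋃ G : X0 p, quotientSet p H G.rep)ᶜ = 0 := by
  have hsub : ∀ v, (⋃ G : X0 p, quotientSet p H G.rep)ᶜ ⊆ boxPow e v Set.univ := by
    intro v h hh
    refine ⟨?_, trivial⟩
    by_cases h0 : (e h).1 = 0
    · rw [h0]; exact dvd_zero _
    · exfalso
      apply hh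
      obtain ⟨f⟩ := nonempty_quotient_equiv e (a := h) (b := ((e h).1, (e h).2)) 1 (one_smul _ _).symm
      have := finite_quotient_of_ne_zero h0 (e h).2
      obtain ⟨g⟩ := X0.nonempty_rep_of_equiv (p := p)
        ((ℤ_[p] × T) ⧸ span ℤ_[p] {((e h).1, (e h).2)})
      exact Set.mem_iUnion.2 ⟨_, ⟨f.trans g.symm⟩⟩
  have hle : ∀ v, μ.real (⋃ G : X0 p, quotientSet p H G.rep)ᶜ ≤ (1 / p : ℝ) ^ v := by
    intro v
    refine (measureReal_mono (hsub v)).trans ?_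
    have hT : (Nat.card T : ℝ) ≠ 0 := by exact_mod_cast Nat.card_pos.ne'
    rw [measureReal_boxPow, Nat.card_congr (Equiv.Set.univ T), one_div_pow,
      div_mul_cancel_right₀ hT, one_div]
  have hlim : Filter.Tendsto (fun v : ℕ => (1 / p : ℝ) ^ v) Filter.atTop (nhds 0) := by
    refine tendsto_pow_atTop_nhds_zero_of_lt_one (by positivity) ?_
    rw [one_div]
    exact inv_lt_one_of_one_lt₀ (by exact_mod_cast (Fact.out : p.Prime).one_lt)
  have := ge_of_tendsto' hlim hle
  exact (measureReal_eq_zero_iff).1 (le_antisymm this measureReal_nonneg)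

/-- A fixed surjection H → F factors through the quotient by `h` exactly when it kills `h`, an event
of probability 1/|F|. The result is summed over the finitely many surjections. -/
theorem hasSum_measureReal_quotientSet_mul (e : H ≃ₗ[ℤ_[p]] ℤ_[p] × T) [Module.Finite ℤ_[p] H]
    (F : Type) [AddCommGroup F] [Module ℤ_[p] F] [Finite F] :
    HasSum (fun G : X0 p => μ.real (quotientSet p H G.rep) *
        Nat.card {f : G.rep →ₗ[ℤ_[p]] F // Function.Surjective f})
      ((Nat.card {f : H →ₗ[ℤ_[p]] F // Function.Surjective f} : ℝ) / Nat.card F) := by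
  classical
  let S := {f : H →ₗ[ℤ_[p]] F // Function.Surjective f}
  have := Fintype.ofFinite S
  have hker : ∀ f : S, MeasurableSet (f.1 ⁻¹' {0}) := fun f =>
    (isOpen_preimage_of_finite _ _).measurableSet
  have hquot : ∀ G : X0 p, MeasurableSet (quotientSet p H G.rep) := fun G =>
    (isOpen_quotientSet e).measurableSet
  have h1 : ∀ f : S, HasSum (fun G : X0 p => μ.real (quotientSet p H G.rep ∩ f.1 ⁻¹' {0}))
      (1 / Nat.card F) := by
    intro f
    have h2 : μ (⋃ G : X0 p, quotientSet p H G.rep ∩ f.1 ⁻¹' {0}) =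
        ∑' G : X0 p, μ (quotientSet p H G.rep ∩ f.1 ⁻¹' {0}) := by
      refine measure_iUnion ?_ fun G => (hquot G).inter (hker f)
      intro G G' hGG'
      refine Set.disjoint_left.2 ?_
      rintro h ⟨⟨g⟩, -⟩ ⟨⟨g'⟩, -⟩
      exact hGG' (X0.ext_iff_nonempty.2 ⟨g.symm.trans g'⟩)
    have h3 : μ (⋃ G : X0 p, quotientSet p H G.rep ∩ f.1 ⁻¹' {0}) = μ (f.1 ⁻¹' {0}) := by
      rw [← Set.iUnion_inter, Set.inter_comm]
      exact measure_inter_conull (measure_iUnion_quotientSet_compl e)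
    have h4 := measureReal_preimage_of_finite (μ := μ) f.2 {0}
    rw [Nat.card_unique, Nat.cast_one] at h4
    rw [← h4, measureReal_def, ← h3, h2, ENNReal.tsum_toReal_eq fun _ => measure_ne_top _ _]
    exact (ENNReal.hasSum_toReal (by rw [← h2]; exact measure_ne_top _ _))
  have h5 := hasSum_sum (s := Finset.univ) fun f _ => h1 f
  rw [Finset.sum_const, Finset.card_univ, ← Nat.card_eq_fintype_card, nsmul_eq_mul, mul_one_div]
    at h5
  refine h5.congr_fun fun G => ?_
  -- The sum over surjections is moved inside the integral; there it is constant on `quotientSet`,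
  -- equal to the number of surjections G → F.
  have h6 : ∀ f : S, μ.real (quotientSet p H G.rep ∩ f.1 ⁻¹' {0}) =
      ∫ h, (quotientSet p H G.rep ∩ f.1 ⁻¹' {0}).indicator (fun _ => (1 : ℝ)) h ∂μ := fun f => by
    rw [integral_indicator_const _ ((hquot G).inter (hker f)), smul_eq_mul, mul_one]
  rw [Finset.sum_congr rfl fun f _ => h6 f, ← integral_finsetSum _ fun f _ =>
    (integrable_const (1 : ℝ)).indicator ((hquot G).inter (hker f))]
  rw [← smul_eq_mul, ← integral_indicator_const _ (hquot G)]
  congr 1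
  ext h
  by_cases hh : h ∈ quotientSet p H G.rep
  · rw [Set.indicator_of_mem hh, card_surjective_quotient hh, Nat.card_eq_fintype_card,
      Fintype.card_subtype, Finset.card_filter]
    push_cast
    refine Finset.sum_congr rfl fun f _ => ?_
    simp [Set.indicator_apply, hh]
  · rw [Set.indicator_of_notMem hh]
    exact (Finset.sum_eq_zero fun f _ => Set.indicator_of_notMem (fun h => hh h.1) _).symm

end Quotient

end Haar

/-! ### Counting identity for surjections from middle terms -/

section HomCounting

variable {p : ℕ} [Fact p.Prime]

/-- The number of homomorphisms. -/
noncomputable def homCount (p : ℕ) [Fact p.Prime] (A B : Type*) [AddCommGroup A] [Module ℤ_[p] A]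
    [AddCommGroup B] [Module ℤ_[p] B] : ℕ := Nat.card (A →ₗ[ℤ_[p]] B)

/-- The number of surjective homomorphisms. -/
noncomputable def surCount (p : ℕ) [Fact p.Prime] (A B : Type*) [AddCommGroup A] [Module ℤ_[p] A]
    [AddCommGroup B] [Module ℤ_[p] B] : ℕ :=
  Nat.card {f : A →ₗ[ℤ_[p]] B // Function.Surjective f}

section Congr

variable {A A' B B' : Type*} [AddCommGroup A] [Module ℤ_[p] A] [AddCommGroup A'] [Module ℤ_[p] A']
  [AddCommGroup B] [Module ℤ_[p] B] [AddCommGroup B'] [Module ℤ_[p] B']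

theorem homCount_congr (e : A ≃ₗ[ℤ_[p]] A') (f : B ≃ₗ[ℤ_[p]] B') :
    homCount p A B = homCount p A' B' :=
  Nat.card_congr (LinearEquiv.arrowCongr e f).toEquiv

theorem surCount_congr (e : A ≃ₗ[ℤ_[p]] A') (f : B ≃ₗ[ℤ_[p]] B') :
    surCount p A B = surCount p A' B' :=
  Nat.card_congr ((LinearEquiv.arrowCongr e f).toEquiv.subtypeEquiv fun g => by
    change _ ↔ Function.Surjective (f ∘ (g ∘ e.symm))
    exact (e.symm.surjective.of_comp_iff g).symm.trans
      (Function.Surjective.of_comp_iff' f.bijective (g ∘ e.symm)).symm)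

/-- Homomorphisms to a submodule. -/
theorem homCount_submodule (K : Submodule ℤ_[p] B) :
    homCount p A K = Nat.card {f : A →ₗ[ℤ_[p]] B // ∀ x, f x ∈ K} :=
  Nat.card_congr
    { toFun := fun f => ⟨K.subtype ∘ₗ f, fun x => (f x).2⟩
      invFun := fun f => f.1.codRestrict K f.2
      left_inv := fun _ => rfl
      right_inv := fun _ => rfl }

/-- Homomorphisms from a quotient. -/
theorem homCount_quotient (N : Submodule ℤ_[p] A) :
    homCount p (A ⧸ N) B = Nat.card {f : A →ₗ[ℤ_[p]] B // ∀ x ∈ N, f x = 0} :=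
  Nat.card_congr
    { toFun := fun f => ⟨f ∘ₗ N.mkQ, fun x hx => by
        rw [LinearMap.comp_apply, mkQ_apply, (Submodule.Quotient.mk_eq_zero N).2 hx, map_zero]⟩
      invFun := fun f => N.liftQ f.1 fun x hx => f.2 x hx
      left_inv := fun f => by ext; rfl
      right_inv := fun f => rfl }

theorem homCount_free_prod : homCount p (ℤ_[p] × A) B = Nat.card B * homCount p A B := by
  rw [homCount, homCount, ← Nat.card_prod]
  refine Nat.card_congr ((LinearMap.coprodEquiv ℤ_[p]).symm.toEquiv.trans
    (Equiv.prodCongr (LinearMap.ringLmapEquivSelf ℤ_[p] ℤ_[p] B).toEquiv (Equiv.refl _)))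

theorem surCount_range_eq (N : Submodule ℤ_[p] B) :
    surCount p A N = Nat.card {f : A →ₗ[ℤ_[p]] B // LinearMap.range f = N} :=
  Nat.card_congr
    { toFun := fun f => ⟨N.subtype ∘ₗ f.1, by
        rw [LinearMap.range_comp, LinearMap.range_eq_top.2 f.2, Submodule.map_top, range_subtype]⟩
      invFun := fun f => ⟨f.1.codRestrict N fun x => f.2.le (LinearMap.mem_range_self _ _), by
        rintro ⟨y, hy⟩
        obtain ⟨x, rfl⟩ := f.2.ge hy
        exact ⟨x, rfl⟩⟩
      left_inv := fun f => rfl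
      right_inv := fun f => rfl }

/-- Every homomorphism is a surjection onto its range. -/
theorem homCount_eq_sum_surCount [Finite (A →ₗ[ℤ_[p]] B)] [Fintype (Submodule ℤ_[p] B)] :
    homCount p A B = ∑ N : Submodule ℤ_[p] B, surCount p A N := by
  rw [Finset.sum_congr rfl fun N _ => surCount_range_eq N, ← Nat.card_sigma, homCount]
  exact Nat.card_congr (Equiv.sigmaFiberEquiv fun f : A →ₗ[ℤ_[p]] B => LinearMap.range f).symm

end Congr

variable {G F : Type} [AddCommGroup G] [Module ℤ_[p] G] [AddCommGroup F] [Module ℤ_[p] F]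

/-- This is the term-by-term comparison, over s in Hom(G, F), of the two sums of Hom counts
evaluated next. -/
theorem card_mul_card_ker (s : G →ₗ[ℤ_[p]] F) :
    Nat.card F * Nat.card (LinearMap.ker s) = Nat.card G * Nat.card (F ⧸ LinearMap.range s) := by
  rw [card_eq_card_ker_mul_card_range s, Submodule.card_eq_card_quotient_mul_card (LinearMap.range s)]
  ring

variable [Finite G] [Finite F]

/-- By duality the kernels become the quotients of G by its elements x; both sides then count pairs
(s, x) with s(x) = 0. -/
theorem sum_homCount_ker [Fintype (G →ₗ[ℤ_[p]] F)] [Fintype (G →ₗ[ℤ_[p]] Prufer p)] :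
    ∑ φ : G →ₗ[ℤ_[p]] Prufer p, homCount p (LinearMap.ker φ) F =
      ∑ s : G →ₗ[ℤ_[p]] F, Nat.card (LinearMap.ker s) := by
  have := Fintype.ofFinite G
  obtain ⟨θ, hθ⟩ := exists_equiv_ker_quotient p G
  rw [← Equiv.sum_comp θ]
  have h1 : ∀ x, homCount p (LinearMap.ker (θ x)) F = Nat.card {s : G →ₗ[ℤ_[p]] F // s x = 0} := by
    intro x
    rw [homCount_congr (hθ x).some (LinearEquiv.refl _ F), homCount_quotient]
    refine Nat.card_congr (Equiv.subtypeEquivRight fun s => ?_)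
    exact (span_singleton_le_iff_mem (p := LinearMap.ker s) x)
  rw [Finset.sum_congr rfl fun x _ => h1 x, ← Nat.card_sigma]
  change _ = ∑ s : G →ₗ[ℤ_[p]] F, Nat.card {x // s x = 0}
  rw [← Nat.card_sigma]
  exact Nat.card_congr
    { toFun := fun y => ⟨y.2.1, y.1, y.2.2⟩
      invFun := fun y => ⟨y.2.1, y.1, y.2.2⟩
      left_inv := fun y => rfl
      right_inv := fun y => rfl }

/-- By duality F/⟨x⟩ becomes the kernel of a character; both sides count pairs of a map s and a
character of F vanishing on its range, that is, a character of the cokernel. -/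
theorem sum_homCount_quotient [Fintype F] [Fintype (G →ₗ[ℤ_[p]] F)] :
    ∑ x : F, homCount p G (F ⧸ span ℤ_[p] {x}) =
      ∑ s : G →ₗ[ℤ_[p]] F, Nat.card (F ⧸ LinearMap.range s) := by
  have := Fintype.ofFinite (F →ₗ[ℤ_[p]] Prufer p)
  obtain ⟨θ, hθ⟩ := exists_equiv_ker_quotient p F
  have h1 : ∀ x, homCount p G (F ⧸ span ℤ_[p] {x}) =
      Nat.card {s : G →ₗ[ℤ_[p]] F // θ x ∘ₗ s = 0} := by
    intro x
    rw [homCount_congr (LinearEquiv.refl _ G) (hθ x).some.symm, homCount_submodule]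
    refine Nat.card_congr (Equiv.subtypeEquivRight fun s => ?_)
    exact (LinearMap.ext_iff (f := θ x ∘ₗ s) (g := 0)).symm
  have h2 : ∀ s : G →ₗ[ℤ_[p]] F, Nat.card (F ⧸ LinearMap.range s) =
      Nat.card {x : F // θ x ∘ₗ s = 0} := by
    intro s
    rw [← card_dual p (F ⧸ LinearMap.range s)]
    refine (homCount_quotient (B := Prufer p) (LinearMap.range s)).trans
      (Nat.card_congr (θ.subtypeEquiv fun x => ?_).symm)
    rw [LinearMap.ext_iff]
    constructor
    · rintro h _ ⟨y, rfl⟩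
      exact h y
    · intro h y
      exact h _ ⟨y, rfl⟩
  rw [Finset.sum_congr rfl fun x _ => h1 x, Finset.sum_congr rfl fun s _ => h2 s,
    ← Nat.card_sigma, ← Nat.card_sigma]
  exact Nat.card_congr
    { toFun := fun y => ⟨y.2.1, y.1, y.2.2⟩
      invFun := fun y => ⟨y.2.1, y.1, y.2.2⟩
      left_inv := fun y => rfl
      right_inv := fun y => rfl }

/-- Sum of the surjections onto the quotients of the submodules by cyclic submodules. -/
theorem sum_sum_surCount_quotient [Fintype F] [Fintype (Submodule ℤ_[p] F)]
    [∀ N : Submodule ℤ_[p] F, Fintype N] :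
    ∑ N : Submodule ℤ_[p] F, ∑ x : N, surCount p G (N ⧸ span ℤ_[p] {x}) =
      ∑ x : F, homCount p G (F ⧸ span ℤ_[p] {x}) := by
  have h1 : ∀ (N : Submodule ℤ_[p] F) (x : N), surCount p G (N ⧸ span ℤ_[p] {x}) =
      Nat.card {h : G →ₗ[ℤ_[p]] F ⧸ span ℤ_[p] {(x : F)} //
        LinearMap.range h = N.map (Submodule.mkQ _)} := by
    intro N x
    let f : N →ₗ[ℤ_[p]] F ⧸ span ℤ_[p] {(x : F)} := Submodule.mkQ _ ∘ₗ N.subtype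
    have hk : span ℤ_[p] {x} = LinearMap.ker f := by
      apply Submodule.map_injective_of_injective N.injective_subtype
      rw [LinearMap.ker_comp, Submodule.ker_mkQ, Submodule.map_comap_subtype, Submodule.map_span,
        Set.image_singleton, Submodule.subtype_apply, eq_comm]
      exact inf_eq_right.2 ((span_singleton_le_iff_mem _ _).2 x.2)
    have hr : LinearMap.range f = N.map (Submodule.mkQ _) := by
      rw [LinearMap.range_comp, range_subtype]
    rw [surCount_congr (LinearEquiv.refl _ G) ((Submodule.quotEquivOfEq _ _ hk).trans
      f.quotKerEquivRange), surCount_range_eq, hr]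
  rw [Finset.sum_congr rfl fun N _ => (Finset.sum_congr rfl fun x _ => h1 N x)]
  simp_rw [homCount, ← Nat.card_sigma]
  -- The submodule N contains x, so it is recovered from (x, h) as the preimage of the range of h.
  refine Nat.card_congr (Equiv.ofBijective
    (fun y => (⟨y.2.1, y.2.2.1⟩ : Σ x : F, (G →ₗ[ℤ_[p]] F ⧸ span ℤ_[p] {x}))) ⟨?_, ?_⟩)
  · rintro ⟨N, ⟨x, hx⟩, h, hh⟩ ⟨N', ⟨x', hx'⟩, h', hh'⟩ heq
    obtain ⟨rfl, heq⟩ := Sigma.mk.inj_iff.1 heq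
    obtain rfl := eq_of_heq heq
    have key : ∀ N : Submodule ℤ_[p] F, x ∈ N →
        (N.map (span ℤ_[p] {x}).mkQ).comap (span ℤ_[p] {x}).mkQ = N := by
      intro N hN
      rw [Submodule.comap_map_mkQ]
      exact sup_eq_right.2 ((span_singleton_le_iff_mem _ _).2 hN)
    obtain rfl : N = N' := by
      rw [← key N hx, ← key N' hx']
      exact congrArg _ (hh.symm.trans hh')
    rfl
  · rintro ⟨x, h⟩
    refine ⟨⟨(LinearMap.range h).comap (Submodule.mkQ _), ⟨x, ?_⟩, h, ?_⟩, rfl⟩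
    · rw [Submodule.mem_comap, mkQ_apply,
        (Submodule.Quotient.mk_eq_zero _).2 (mem_span_singleton_self x)]
      exact zero_mem _
    · rw [Submodule.map_comap_eq, range_mkQ, top_inf_eq]

/-- Summed over all submodules of F, both sides become Hom counts, where the identity is known.
Strong induction on |F| cancels the proper submodules and leaves the term of F itself. -/
theorem sum_surCount_prod_ker_eq_quotient [Fintype (G →ₗ[ℤ_[p]] Prufer p)] :
    ∀ (n : ℕ) (F : Type) [AddCommGroup F] [Module ℤ_[p] F] [Fintype F], Nat.card F = n →
    ∑ φ : G →ₗ[ℤ_[p]] Prufer p, surCount p (ℤ_[p] × LinearMap.ker φ) F =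
      Nat.card G * ∑ x : F, surCount p G (F ⧸ span ℤ_[p] {x}) := by
  classical
  intro n
  induction n using Nat.strong_induction_on with
  | _ n ih =>
    intro F _ _ _ hF
    have := Fintype.ofFinite (G →ₗ[ℤ_[p]] F)
    have : Finite (Submodule ℤ_[p] F) := .of_injective _ SetLike.coe_injective
    have := Fintype.ofFinite (Submodule ℤ_[p] F)
    have : ∀ N : Submodule ℤ_[p] F, Fintype N := fun N => Fintype.ofFinite N
    have hsum : ∑ N : Submodule ℤ_[p] F, ∑ φ : G →ₗ[ℤ_[p]] Prufer p,
        surCount p (ℤ_[p] × LinearMap.ker φ) N =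
        ∑ N : Submodule ℤ_[p] F, Nat.card G * ∑ x : N, surCount p G (N ⧸ span ℤ_[p] {x}) := by
      rw [Finset.sum_comm, Finset.sum_congr rfl fun φ _ => homCount_eq_sum_surCount.symm,
        Finset.sum_congr rfl fun φ _ => homCount_free_prod, ← Finset.mul_sum, sum_homCount_ker,
        ← Finset.mul_sum, sum_sum_surCount_quotient, sum_homCount_quotient, Finset.mul_sum,
        Finset.mul_sum]
      exact Finset.sum_congr rfl fun s _ => card_mul_card_ker s
    rw [← Finset.add_sum_erase _ _ (Finset.mem_univ (⊤ : Submodule ℤ_[p] F)),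
      ← Finset.add_sum_erase _ _ (Finset.mem_univ (⊤ : Submodule ℤ_[p] F))] at hsum
    have herase := Finset.sum_congr (s₁ := Finset.univ.erase (⊤ : Submodule ℤ_[p] F)) rfl
      fun N hN => ih (Nat.card N) (hF ▸ by
        have hN' : N < ⊤ := lt_top_iff_ne_top.2 (Finset.ne_of_mem_erase hN)
        rw [← Nat.card_congr (Submodule.topEquiv (R := ℤ_[p]) (M := F)).toEquiv]
        exact Set.ncard_lt_ncard hN' (Set.toFinite _)) N rfl
    rw [herase] at hsum
    have htop := Nat.add_right_cancel hsum
    let e : (⊤ : Submodule ℤ_[p] F) ≃ₗ[ℤ_[p]] F := Submodule.topEquiv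
    rw [Finset.sum_congr rfl fun φ _ => surCount_congr (LinearEquiv.refl _ _) e] at htop
    rw [htop, ← Equiv.sum_comp e.toEquiv]
    congr 1
    refine Finset.sum_congr rfl fun x _ => surCount_congr (LinearEquiv.refl _ _) ?_
    exact Submodule.Quotient.equiv _ _ e (by
      rw [Submodule.map_span, Set.image_singleton]; rfl)

/-- The surjections from the middle terms of the extensions of `G` by `ℤ_p` to `F`, counted through
the kernels of the characters of `F`. -/
theorem sum_surCount_prod_ker [Fintype (G →ₗ[ℤ_[p]] Prufer p)] [Fintype (F →ₗ[ℤ_[p]] Prufer p)] :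
    ∑ φ : G →ₗ[ℤ_[p]] Prufer p, surCount p (ℤ_[p] × LinearMap.ker φ) F =
      Nat.card G * ∑ ψ : F →ₗ[ℤ_[p]] Prufer p, surCount p G (LinearMap.ker ψ) := by
  have := Fintype.ofFinite F
  rw [sum_surCount_prod_ker_eq_quotient _ F rfl]
  obtain ⟨θ, hθ⟩ := exists_equiv_ker_quotient p F
  rw [← Equiv.sum_comp θ]
  exact congrArg _ (Finset.sum_congr rfl fun x _ =>
    surCount_congr (LinearEquiv.refl _ _) (hθ x).some.symm)

end HomCounting

/-! ### Detailed balance and the intertwining of δ₀ with Δ₀ -/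

section Intertwining

variable {p : ℕ} [Fact p.Prime]

/-- The class of the torsion part of a module of rank one. -/
noncomputable def X1.torsion (H : X1 p) : X0 p := H.exists_equiv_prod.choose

theorem X1.nonempty_equiv_prod_torsion (H : X1 p) :
    Nonempty (H.rep ≃ₗ[ℤ_[p]] ℤ_[p] × H.torsion.rep) := H.exists_equiv_prod.choose_spec

/-- The measure on `X₁` with respect to which `d` is adjoint to `d*`. -/
noncomputable def mu1 (H : X1 p) : ℝ :=
  (∏' i : ℕ, (1 - 1 / (p : ℝ) ^ (i + 1))) /
    ((1 - 1 / p) * (H.torsion.numAut * H.torsion.order))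

theorem one_sub_one_div_prime_ne_zero (p : ℕ) [Fact p.Prime] : (1 - 1 / p : ℝ) ≠ 0 := by
  have : (1 : ℝ) < p := by exact_mod_cast (Fact.out : p.Prime).one_lt
  exact (sub_pos.2 ((div_lt_one (by positivity)).2 this)).ne'

theorem X0.numAut_pos (G : X0 p) : 0 < G.numAut := Nat.card_pos

/-- Detailed balance: `d` and `d*` are adjoint. -/
theorem mu0_mul_probDStar (G : X0 p) (H : X1 p) :
    mu0 G * probDStar G H = mu1 H * probD H G := by
  obtain ⟨e⟩ := H.nonempty_equiv_prod_torsion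
  obtain ⟨_, _, _, _, _, μ, _, _, hμ⟩ := exists_haarProb_eq p H.rep
  have h1 : probD H G = μ.real (quotientSet p H.rep G.rep) := hμ _
  have h2 : Nat.card {φ : Dual0 G // Nonempty ((ℤ_[p] × LinearMap.ker φ) ≃ₗ[ℤ_[p]] H.rep)} =
      Nat.card {φ : G.rep →ₗ[ℤ_[p]] Prufer p //
        Nonempty (LinearMap.ker φ ≃ₗ[ℤ_[p]] H.torsion.rep)} := by
    refine Nat.card_congr (Equiv.subtypeEquivRight fun φ => ⟨?_, ?_⟩)
    · rintro ⟨f⟩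
      exact nonempty_equiv_of_prod_equiv (f.trans e)
    · rintro ⟨f⟩
      exact ⟨(LinearEquiv.prodCongr (LinearEquiv.refl _ _) f).trans e.symm⟩
  rw [card_dual_prod_equiv_eq_probDStar, h1, measureReal_quotientSet e, h2, mu0, mu1]
  have hG : (G.numAut : ℝ) ≠ 0 := by exact_mod_cast G.numAut_pos.ne'
  have hT : (H.torsion.numAut : ℝ) ≠ 0 := by exact_mod_cast H.torsion.numAut_pos.ne'
  have hT' : (H.torsion.order : ℝ) ≠ 0 := by exact_mod_cast H.torsion.order_pos.ne'
  have hG' : (G.order : ℝ) ≠ 0 := by exact_mod_cast G.order_pos.ne'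
  have hp := one_sub_one_div_prime_ne_zero p
  change _ = _ * ((1 - 1 / p) / (G.order : ℝ) *
    (_ * ((H.torsion.numAut : ℝ) * (H.torsion.order : ℝ)) / (G.numAut : ℝ)))
  generalize (1 - 1 / p : ℝ) = r at hp ⊢
  field_simp

theorem hasSum_probD_mul_numSur (H : X1 p) (F : X0 p) :
    HasSum (fun G => probD H G * G.numSur F) ((surCount p H.rep F.rep : ℝ) / F.order) := by
  obtain ⟨e⟩ := H.nonempty_equiv_prod_torsion
  obtain ⟨_, _, _, _, _, μ, _, _, hμ⟩ := exists_haarProb_eq p H.rep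
  have := hasSum_measureReal_quotientSet_mul (μ := μ) e F.rep
  simp_rw [← hμ] at this
  exact this

/-- The law of d*G is the average of point masses at ℤ_p × ker φ, so this is `sum_surCount_prod_ker`
divided by |G|. -/
theorem hasSum_probDStar_mul_surCount (G F : X0 p) [Fintype (Dual0 F)] :
    HasSum (fun H : X1 p => probDStar G H * surCount p H.rep F.rep)
      (∑ ψ : Dual0 F, (surCount p G.rep (LinearMap.ker ψ) : ℝ)) := by
  classical
  have := Fintype.ofFinite (Dual0 G)
  have hG : (G.order : ℝ) ≠ 0 := by exact_mod_cast G.order_pos.ne'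
  let c : Dual0 G → X1 p := fun φ => X1.of p (ℤ_[p] × LinearMap.ker φ) (rank_one_prod p _)
  have h1 : ∀ φ : Dual0 G, HasSum
      (fun H : X1 p => if H = c φ then (surCount p H.rep F.rep : ℝ) / G.order else 0)
      ((surCount p (ℤ_[p] × LinearMap.ker φ) F.rep : ℝ) / G.order) := by
    intro φ
    obtain ⟨e⟩ := X1.nonempty_rep_of_equiv (p := p) (ℤ_[p] × LinearMap.ker φ) (rank_one_prod p _)
    rw [← surCount_congr e (LinearEquiv.refl _ _)]
    exact hasSum_ite_eq (c φ) _ |>.congr_fun fun H => by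
      split_ifs with h
      · rw [h]
      · rfl
  have h2 := hasSum_sum (s := Finset.univ) fun φ _ => h1 φ
  have h3 : ∑ φ : Dual0 G, (surCount p (ℤ_[p] × LinearMap.ker φ) F.rep : ℝ) / G.order =
      ∑ ψ : Dual0 F, (surCount p G.rep (LinearMap.ker ψ) : ℝ) := by
    have := congrArg (Nat.cast (R := ℝ)) (sum_surCount_prod_ker (p := p) (G := G.rep) (F := F.rep))
    push_cast at this
    rw [← Finset.sum_div, div_eq_iff hG, mul_comm]
    exact this
  rw [← h3]
  refine h2.congr_fun fun H => ?_
  rw [card_dual_prod_equiv_eq_probDStar, Nat.card_eq_fintype_card, Fintype.card_subtype,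
    Finset.card_filter, div_mul_eq_mul_div]
  push_cast
  rw [Finset.sum_mul, Finset.sum_div]
  refine Finset.sum_congr rfl fun φ _ => ?_
  have : H = c φ ↔ Nonempty ((ℤ_[p] × LinearMap.ker φ) ≃ₗ[ℤ_[p]] H.rep) :=
    eq_comm.trans X1.of_eq_iff
  simp only [this]
  split_ifs <;> simp

theorem Moment_apply (e : X0 p →₀ ℝ) (G : X0 p) :
    Moment p e G = ∑ F ∈ e.support, e F * moment F G := by
  rw [Moment, Finsupp.linearCombination_apply, Finsupp.sum, Finset.sum_apply]
  rfl

/-- Detailed balance turns the sum over G into a mean for the random quotient of H. -/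
theorem dStar_Moment (e : X0 p →₀ ℝ) (H : X1 p) :
    dStar (Moment p e) H =
      mu1 H * ∑ F ∈ e.support, e F * ((surCount p H.rep F.rep : ℝ) / F.order) := by
  have h := (hasSum_sum (s := e.support) fun F _ =>
    (hasSum_probD_mul_numSur H F).mul_left (e F)).mul_left (mu1 H)
  rw [← h.tsum_eq, dStar]
  refine tsum_congr fun G => ?_
  rw [Moment_apply, Finset.sum_mul, Finset.mul_sum]
  refine Finset.sum_congr rfl fun F _ => ?_
  calc e F * moment F G * probDStar G H
      = e F * G.numSur F * (mu0 G * probDStar G H) := by rw [moment]; ring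
    _ = _ := by rw [mu0_mul_probDStar]; ring

/-- Detailed balance is used in the opposite direction, turning the sum over H into a mean for d*G.
-/
theorem Delta0_Moment_apply [∀ F : X0 p, Fintype (Dual0 F)] (e : X0 p →₀ ℝ) (G : X0 p) :
    Delta0 (Moment p e) G = mu0 G * ∑ F ∈ e.support,
      e F / F.order * ∑ ψ : Dual0 F, (surCount p G.rep (LinearMap.ker ψ) : ℝ) := by
  have h := (hasSum_sum (s := e.support) fun F _ =>
    (hasSum_probDStar_mul_surCount G F).mul_left (e F / F.order)).mul_left (mu0 G)
  rw [← h.tsum_eq, Delta0, dOp]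
  refine tsum_congr fun H => ?_
  rw [dStar_Moment, Finset.mul_sum, Finset.mul_sum, Finset.sum_mul]
  refine Finset.sum_congr rfl fun F _ => ?_
  calc mu1 H * (e F * ((surCount p H.rep F.rep : ℝ) / F.order)) * probD H G
      = e F / F.order * surCount p H.rep F.rep * (mu1 H * probD H G) := by ring
    _ = _ := by rw [← mu0_mul_probDStar]; ring

/-- The operator `δ₀` as a linear endomorphism of the finitely supported signed measures. -/
noncomputable def deltaLinear (p : ℕ) [Fact p.Prime] : (X0 p →₀ ℝ) →ₗ[ℝ] (X0 p →₀ ℝ) :=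
  Finsupp.linearCombination ℝ fun F => letI := Fintype.ofFinite (Dual0 F)
    ∑ ψ : Dual0 F, Finsupp.single (X0.of p (LinearMap.ker ψ)) (1 / (F.order : ℝ))

theorem deltaLinear_single_apply (F K : X0 p) :
    deltaLinear p (Finsupp.single F 1) K = probDelta F K := by
  classical
  have := Fintype.ofFinite (Dual0 F)
  rw [deltaLinear, Finsupp.linearCombination_single, one_smul, Finsupp.finsetSum_apply, probDelta,
    card_dual, Nat.card_eq_fintype_card, Fintype.card_subtype, Finset.card_filter]
  push_cast
  rw [Finset.sum_div]
  refine Finset.sum_congr (by congr; exact Subsingleton.elim _ _) fun ψ _ => ?_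
  rw [Finsupp.single_apply, X0.of_eq_iff]
  change _ = _ / (F.order : ℝ)
  split_ifs <;> simp

theorem deltaLinear_apply (e : X0 p →₀ ℝ) (K : X0 p) :
    deltaLinear p e K = ∑ F ∈ e.support, e F * probDelta F K := by
  conv_lhs => rw [← Finsupp.sum_single e, Finsupp.sum, map_sum, Finsupp.finsetSum_apply]
  refine Finset.sum_congr rfl fun F _ => ?_
  rw [← mul_one (e F), ← smul_eq_mul, ← Finsupp.smul_single, map_smul, Finsupp.smul_apply,
    deltaLinear_single_apply, smul_eq_mul, smul_eq_mul, mul_one]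

theorem coe_deltaLinear (e : X0 p →₀ ℝ) : ⇑(deltaLinear p e) = delta0 e :=
  funext fun K => deltaLinear_apply e K

theorem numSur_of {M : Type} [AddCommGroup M] [Module ℤ_[p] M] [Finite M] (G : X0 p) :
    G.numSur (X0.of p M) = surCount p G.rep M :=
  surCount_congr (LinearEquiv.refl _ _) (X0.nonempty_rep_of_equiv (p := p) M).some

/-- The moment map intertwines `δ₀` and `Δ₀`. -/
theorem Delta0_Moment (e : X0 p →₀ ℝ) : Delta0 (Moment p e) = Moment p (deltaLinear p e) := by
  ext G
  have : ∀ F : X0 p, Fintype (Dual0 F) := fun F => Fintype.ofFinite (Dual0 F)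
  rw [Delta0_Moment_apply, deltaLinear, Finsupp.linearCombination_apply, Finsupp.sum, map_sum,
    Finset.sum_apply, Finset.mul_sum]
  refine Finset.sum_congr rfl fun F _ => ?_
  rw [map_smul, map_sum, Pi.smul_apply, Finset.sum_apply, smul_eq_mul, Finset.mul_sum,
    Finset.mul_sum, Finset.mul_sum]
  refine Finset.sum_congr (by congr; exact Subsingleton.elim _ _) fun ψ _ => ?_
  rw [Moment, Finsupp.linearCombination_single, Pi.smul_apply, moment, numSur_of, smul_eq_mul]
  ring

end Intertwining

/-! ### Summability of the moment measures -/

section Summability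

variable {p : ℕ} [Fact p.Prime]

/-- The number of homomorphisms to `F`, divided by the number of automorphisms. -/
noncomputable def homWeight (F : Type) [AddCommGroup F] [Module ℤ_[p] F] (G : X0 p) : ℝ :=
  (homCount p G.rep F : ℝ) / G.numAut

/-- The classes of order `p ^ n`. -/
noncomputable def X0.level (p : ℕ) [Fact p.Prime] (n : ℕ) : Finset (X0 p) :=
  (X0.finite_order_eq (p := p) (p ^ n)).toFinset

theorem X0.mem_level {n : ℕ} {G : X0 p} : G ∈ X0.level p n ↔ G.order = p ^ n :=
  Set.Finite.mem_toFinset _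

theorem X0.exists_mem_level (G : X0 p) : ∃ n, G ∈ X0.level p n := by
  obtain ⟨n, hn⟩ := exists_card_eq_pow p G.rep
  exact ⟨n, X0.mem_level.2 hn⟩

variable {F : Type} [AddCommGroup F] [Module ℤ_[p] F]

theorem homWeight_nonneg (G : X0 p) : 0 ≤ homWeight F G := by unfold homWeight; positivity

variable [Finite F]

theorem homCount_quotient_le {T : Type} [AddCommGroup T] [Module ℤ_[p] T] [Finite T]
    (N : Submodule ℤ_[p] (ℤ_[p] × T)) :
    homCount p ((ℤ_[p] × T) ⧸ N) F ≤ Nat.card F * homCount p T F := by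
  rw [← homCount_free_prod, homCount_quotient]
  exact Finite.card_subtype_le _

/-- Each `b` contributes to at most one class G, and maps out of a quotient of ℤ_p × T are among the
maps out of ℤ_p × T. -/
theorem sum_homCount_mul_card_le {T : Type} [AddCommGroup T] [Module ℤ_[p] T] [Finite T]
    (v : ℕ) (s : Finset (X0 p)) :
    ∑ G ∈ s, homCount p G.rep F * Nat.card {b : T //
        Nonempty (((ℤ_[p] × T) ⧸ span ℤ_[p] {((p : ℤ_[p]) ^ v, b)}) ≃ₗ[ℤ_[p]] G.rep)} ≤
      Nat.card T * (Nat.card F * homCount p T F) := by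
  classical
  have := Fintype.ofFinite T
  have hfin : ∀ b : T, Finite ((ℤ_[p] × T) ⧸ span ℤ_[p] {((p : ℤ_[p]) ^ v, b)}) := fun b =>
    finite_quotient_of_ne_zero (pow_ne_zero _ PadicInt.p_ne_zero) b
  have h1 : ∀ G : X0 p, homCount p G.rep F * Nat.card {b : T //
        Nonempty (((ℤ_[p] × T) ⧸ span ℤ_[p] {((p : ℤ_[p]) ^ v, b)}) ≃ₗ[ℤ_[p]] G.rep)} =
      ∑ b : T, if X0.of p ((ℤ_[p] × T) ⧸ span ℤ_[p] {((p : ℤ_[p]) ^ v, b)}) = G then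
        homCount p ((ℤ_[p] × T) ⧸ span ℤ_[p] {((p : ℤ_[p]) ^ v, b)}) F else 0 := by
    intro G
    rw [Nat.card_eq_fintype_card, Fintype.card_subtype, Finset.card_filter, Finset.mul_sum]
    refine Finset.sum_congr rfl fun b _ => ?_
    simp only [X0.of_eq_iff]
    split_ifs with h
    · rw [mul_one]
      exact homCount_congr h.some.symm (LinearEquiv.refl _ _)
    · rw [mul_zero]
  rw [Finset.sum_congr rfl fun G _ => h1 G, Finset.sum_comm, Nat.card_eq_fintype_card,
    ← Finset.card_univ, ← smul_eq_mul (Finset.card _), ← Finset.sum_const]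
  refine Finset.sum_le_sum fun b _ => ?_
  rw [Finset.sum_ite_eq]
  split_ifs
  · exact homCount_quotient_le _
  · exact Nat.zero_le _

/-- The double count trades characters of G with kernel T, weighted by 1/|Aut G|, for elements of T
weighted by 1/(|Aut T| |T|). -/
theorem sum_level_homWeight_mul_le {m n : ℕ} (hmn : m ≤ n) {T : X0 p} (hT : T ∈ X0.level p m) :
    ∑ G ∈ X0.level p n, homWeight F G *
        Nat.card {φ : Dual0 G // Nonempty (LinearMap.ker φ ≃ₗ[ℤ_[p]] T.rep)} ≤
      Nat.card F * homWeight F T := by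
  have hA : (0 : ℝ) < T.numAut := by exact_mod_cast T.numAut_pos
  have hO : (0 : ℝ) < T.order := by exact_mod_cast T.order_pos
  have h1 : ∀ G ∈ X0.level p n, homWeight F G *
        Nat.card {φ : Dual0 G // Nonempty (LinearMap.ker φ ≃ₗ[ℤ_[p]] T.rep)} =
      ((homCount p G.rep F * Nat.card {b : T.rep // Nonempty (((ℤ_[p] × T.rep) ⧸
        span ℤ_[p] {((p : ℤ_[p]) ^ (n - m), b)}) ≃ₗ[ℤ_[p]] G.rep)} : ℕ) : ℝ) /
          (T.numAut * T.order) := by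
    intro G hG
    have hv : Nat.card G.rep = p ^ (n - m) * Nat.card T.rep := by
      rw [X0.mem_level] at hG hT
      change G.order = _ * T.order
      rw [hG, hT, ← pow_add, Nat.sub_add_cancel hmn]
    have h2 := congrArg (Nat.cast (R := ℝ)) (card_dual_eq_card_quotient_mul hv)
    push_cast at h2
    have hG : (0 : ℝ) < G.numAut := by exact_mod_cast G.numAut_pos
    change _ * ((T.numAut : ℝ) * (T.order : ℝ)) = _ * (G.numAut : ℝ) at h2
    rw [homWeight, div_mul_eq_mul_div, div_eq_div_iff hG.ne' (mul_pos hA hO).ne', mul_assoc]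
    refine (congrArg (fun x => (homCount p G.rep F : ℝ) * x) h2).trans ?_
    push_cast
    rw [mul_assoc]
  rw [Finset.sum_congr rfl h1, ← Finset.sum_div, div_le_iff₀ (mul_pos hA hO), ← Nat.cast_sum]
  refine (Nat.cast_le.2 (sum_homCount_mul_card_le (n - m) _)).trans ?_
  rw [homWeight]
  push_cast
  change (T.order : ℝ) * _ ≤ _
  refine le_of_eq ?_
  field_simp

/-- Every nontrivial character has a smaller kernel. -/
theorem pow_sub_one_le_sum {n : ℕ} {G : X0 p} (hG : G ∈ X0.level p n) :
    p ^ n - 1 ≤ ∑ m ∈ Finset.range n, ∑ T ∈ X0.level p m,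
      Nat.card {φ : Dual0 G // Nonempty (LinearMap.ker φ ≃ₗ[ℤ_[p]] T.rep)} := by
  classical
  have := Fintype.ofFinite (Dual0 G)
  have h1 : (Finset.univ.erase (0 : Dual0 G)).card = p ^ n - 1 := by
    rw [Finset.card_erase_of_mem (Finset.mem_univ _), Finset.card_univ,
      ← Nat.card_eq_fintype_card, card_dual]
    congr 1
    exact X0.mem_level.1 hG
  have h2 : ∀ T : X0 p, Nat.card {φ : Dual0 G // Nonempty (LinearMap.ker φ ≃ₗ[ℤ_[p]] T.rep)} =
      (Finset.univ.filter fun φ : Dual0 G => Nonempty (LinearMap.ker φ ≃ₗ[ℤ_[p]] T.rep)).card :=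
    fun T => by rw [Nat.card_eq_fintype_card, Fintype.card_subtype]
  rw [← h1]
  refine (Finset.card_le_card (t := (Finset.range n).biUnion fun m => (X0.level p m).biUnion
    fun T => Finset.univ.filter fun φ : Dual0 G => Nonempty (LinearMap.ker φ ≃ₗ[ℤ_[p]] T.rep))
    fun φ hφ => ?_).trans ?_
  · have hφ := Finset.ne_of_mem_erase hφ
    obtain ⟨m, hm⟩ := (X0.of p (LinearMap.ker φ)).exists_mem_level
    obtain ⟨e⟩ := X0.nonempty_rep_of_equiv (p := p) (LinearMap.ker φ)
    refine Finset.mem_biUnion.2 ⟨m, Finset.mem_range.2 ?_, Finset.mem_biUnion.2 ⟨_, hm,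
      Finset.mem_filter.2 ⟨Finset.mem_univ _, ⟨e.symm⟩⟩⟩⟩
    have hlt : Nat.card (LinearMap.ker φ) < Nat.card G.rep := by
      refine lt_of_lt_of_eq (Set.ncard_lt_ncard (s := (LinearMap.ker φ : Set G.rep))
        (Set.ssubset_univ_iff.2 fun h => hφ ?_) (Set.toFinite _)) (Set.ncard_univ _)
      exact LinearMap.ext fun x => (h.symm ▸ Set.mem_univ x : x ∈ (LinearMap.ker φ : Set G.rep))
    rw [X0.mem_level] at hm hG
    have h3 : Nat.card (LinearMap.ker φ) = p ^ m := (Nat.card_congr e.toEquiv).symm.trans hm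
    rw [h3, show Nat.card G.rep = p ^ n from hG] at hlt
    exact (Nat.pow_lt_pow_iff_right (Fact.out : p.Prime).one_lt).1 hlt
  · refine Finset.card_biUnion_le.trans (Finset.sum_le_sum fun m _ => ?_)
    refine Finset.card_biUnion_le.trans (Finset.sum_le_sum fun T _ => (h2 T).ge)

/-- Counts pairs of a group G of order pⁿ and a nonzero character, grouped by the class of the
kernel. -/
theorem sum_level_homWeight_le (n : ℕ) :
    ((p : ℝ) ^ n - 1) * ∑ G ∈ X0.level p n, homWeight F G ≤
      Nat.card F * ∑ m ∈ Finset.range n, ∑ T ∈ X0.level p m, homWeight F T := by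
  have h1 : ∀ G ∈ X0.level p n, ((p : ℝ) ^ n - 1) * homWeight F G ≤
      ∑ m ∈ Finset.range n, ∑ T ∈ X0.level p m, homWeight F G *
        Nat.card {φ : Dual0 G // Nonempty (LinearMap.ker φ ≃ₗ[ℤ_[p]] T.rep)} := by
    intro G hG
    have h2 := (Nat.cast_le (α := ℝ)).2 (pow_sub_one_le_sum hG)
    rw [Nat.cast_sub (Nat.one_le_pow _ _ (Fact.out : p.Prime).pos)] at h2
    push_cast at h2
    simp_rw [← Finset.mul_sum]
    rw [mul_comm]
    exact mul_le_mul_of_nonneg_left h2 (homWeight_nonneg G)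
  rw [Finset.mul_sum]
  refine (Finset.sum_le_sum h1).trans ?_
  rw [Finset.sum_comm, Finset.mul_sum]
  refine Finset.sum_le_sum fun m hm => ?_
  rw [Finset.sum_comm, Finset.mul_sum]
  exact Finset.sum_le_sum fun T hT => sum_level_homWeight_mul_le (Finset.mem_range.1 hm).le hT

/-- A discrete Grönwall inequality. -/
theorem sum_range_le_of_two_pow_sub_one_mul_le {B : ℕ → ℝ} {C : ℝ} (hB : ∀ n, 0 ≤ B n)
    (hC : 0 ≤ C) (h : ∀ n, ((2 : ℝ) ^ n - 1) * B n ≤ C * ∑ m ∈ Finset.range n, B m) (n : ℕ) :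
    ∑ m ∈ Finset.range (n + 1), B m ≤ B 0 * Real.exp (2 * C * (1 - 1 / 2 ^ n)) := by
  induction n with
  | zero => simp
  | succ n ih =>
    have hS : 0 ≤ ∑ m ∈ Finset.range (n + 1), B m := Finset.sum_nonneg fun m _ => hB m
    have h2 : (0 : ℝ) < 2 ^ n := by positivity
    -- Uses 2^(n+1) − 1 ≥ 2^n. The exponent in the bound is the sum of C/2^k over k < n, namely 2C(1
    -- − 2^(−n)).
    have h3 : B (n + 1) ≤ C / 2 ^ n * ∑ m ∈ Finset.range (n + 1), B m := by
      rw [div_mul_eq_mul_div, le_div_iff₀ h2, mul_comm]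
      refine le_trans (mul_le_mul_of_nonneg_right ?_ (hB _)) (h (n + 1))
      have : (1 : ℝ) ≤ 2 ^ n := one_le_pow₀ (by norm_num)
      rw [pow_succ]
      linarith
    have h4 : 1 + C / 2 ^ n ≤ Real.exp (C / 2 ^ n) := by
      rw [add_comm]; exact Real.add_one_le_exp _
    calc ∑ m ∈ Finset.range (n + 1 + 1), B m
        = (∑ m ∈ Finset.range (n + 1), B m) + B (n + 1) := Finset.sum_range_succ _ _
      _ ≤ (∑ m ∈ Finset.range (n + 1), B m) * (1 + C / 2 ^ n) := by linarith
      _ ≤ (B 0 * Real.exp (2 * C * (1 - 1 / 2 ^ n))) * Real.exp (C / 2 ^ n) :=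
          mul_le_mul ih h4 (by positivity) (mul_nonneg (hB 0) (Real.exp_pos _).le)
      _ = B 0 * Real.exp (2 * C * (1 - 1 / 2 ^ (n + 1))) := by
          rw [mul_assoc, ← Real.exp_add]
          congr 2
          rw [pow_succ]
          field_simp
          ring

/-- The recursion over orders, weakened from p to 2, bounds all partial sums by B 0 · exp(2|F|). -/
theorem summable_homWeight : Summable (homWeight (p := p) F) := by
  classical
  let B : ℕ → ℝ := fun n => ∑ G ∈ X0.level p n, homWeight F G
  have hB : ∀ n, 0 ≤ B n := fun n => Finset.sum_nonneg fun G _ => homWeight_nonneg G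
  have hC : (0 : ℝ) ≤ Nat.card F := Nat.cast_nonneg _
  have h2p : (2 : ℝ) ≤ p := by exact_mod_cast (Fact.out : p.Prime).two_le
  have hbound := sum_range_le_of_two_pow_sub_one_mul_le hB hC fun n => by
    refine le_trans (mul_le_mul_of_nonneg_right ?_ (hB n)) (sum_level_homWeight_le (F := F) n)
    exact sub_le_sub_right (pow_le_pow_left₀ (by norm_num) h2p n) 1
  refine summable_of_sum_le (c := B 0 * Real.exp (2 * Nat.card F)) homWeight_nonneg fun s => ?_
  choose l hl using X0.exists_mem_level (p := p)
  let n := s.sup l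
  have hs : s ⊆ (Finset.range (n + 1)).biUnion (X0.level p) := fun G hG =>
    Finset.mem_biUnion.2 ⟨l G, Finset.mem_range.2 (Nat.lt_succ_of_le (Finset.le_sup hG)), hl G⟩
  refine (Finset.sum_le_sum_of_subset_of_nonneg hs fun G _ _ => homWeight_nonneg G).trans ?_
  rw [Finset.sum_biUnion]
  · refine (hbound n).trans (mul_le_mul_of_nonneg_left (Real.exp_le_exp.2 ?_) (hB 0))
    refine mul_le_of_le_one_right (by positivity) ?_
    have : (0 : ℝ) ≤ 1 / 2 ^ n := by positivity
    linarith
  · intro m _ n _ hmn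
    refine Finset.disjoint_left.2 fun G hm hn => hmn ?_
    rw [X0.mem_level] at hm hn
    exact Nat.pow_right_injective (Fact.out : p.Prime).two_le (hm.symm.trans hn)

theorem cohenLenstraConst_pos (p : ℕ) [Fact p.Prime] :
    0 < ∏' i : ℕ, (1 - 1 / (p : ℝ) ^ (i + 1)) := by
  have hp : (1 : ℝ) < p := by exact_mod_cast (Fact.out : p.Prime).one_lt
  have hpos : ∀ i : ℕ, 0 < 1 - 1 / (p : ℝ) ^ (i + 1) := fun i =>
    sub_pos.2 ((div_lt_one (by positivity)).2 (one_lt_pow₀ hp i.succ_ne_zero))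
  have hsum : Summable fun i : ℕ => -(1 / (p : ℝ) ^ (i + 1)) := by
    refine Summable.neg ?_
    have := (summable_nat_add_iff 1).2 (summable_geometric_of_lt_one (r := 1 / (p : ℝ))
      (by positivity) ((div_lt_one (by positivity)).2 hp))
    simpa only [one_div_pow] using this
  have hlog : Summable fun i : ℕ => Real.log (1 - 1 / (p : ℝ) ^ (i + 1)) := by
    simpa only [sub_eq_add_neg] using Real.summable_log_one_add_of_summable hsum
  rw [← Real.rexp_tsum_eq_tprod hpos hlog]
  exact Real.exp_pos _

theorem mu0_pos (G : X0 p) : 0 < mu0 G :=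
  div_pos (cohenLenstraConst_pos p) (by exact_mod_cast G.numAut_pos)

theorem surCount_le_homCount {A B : Type} [AddCommGroup A] [Module ℤ_[p] A] [Finite A]
    [AddCommGroup B] [Module ℤ_[p] B] [Finite B] : surCount p A B ≤ homCount p A B :=
  Finite.card_subtype_le (α := A →ₗ[ℤ_[p]] B) _

theorem summable_moment (F : X0 p) : Summable (moment F) := by
  refine Summable.of_nonneg_of_le (fun G => mul_nonneg (Nat.cast_nonneg _) (mu0_pos G).le)
    (fun G => ?_) ((summable_homWeight (p := p) (F := F.rep)).mul_left
      (∏' i : ℕ, (1 - 1 / (p : ℝ) ^ (i + 1))))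
  rw [homWeight, ← mul_div_assoc, mul_div_right_comm, moment, mul_comm]
  exact mul_le_mul_of_nonneg_left (Nat.cast_le.2 (surCount_le_homCount (p := p) (A := G.rep) (B := F.rep))) (mu0_pos G).le

/-- Squaring replaces F by F × F, because #Hom(G, F)² = #Hom(G, F × F). -/
theorem squareSummable_moment (F : X0 p) : SquareSummable (moment F) := by
  refine Summable.of_nonneg_of_le (fun G => div_nonneg (sq_nonneg _) (mu0_pos G).le)
    (fun G => ?_) ((summable_homWeight (p := p) (F := F.rep × F.rep)).mul_left
      (∏' i : ℕ, (1 - 1 / (p : ℝ) ^ (i + 1))))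
  have h1 : homCount p G.rep (F.rep × F.rep) = homCount p G.rep F.rep ^ 2 := by
    rw [homCount, homCount, sq, ← Nat.card_prod]
    exact (Nat.card_congr (LinearMap.prodEquiv ℤ_[p]).toEquiv).symm
  have h2 : (G.numSur F : ℝ) ≤ homCount p G.rep F.rep := Nat.cast_le.2 (surCount_le_homCount (p := p) (A := G.rep) (B := F.rep))
  have h3 : moment F G ^ 2 / mu0 G = mu0 G * (G.numSur F : ℝ) ^ 2 := by
    rw [moment]
    field_simp [(mu0_pos G).ne']
  rw [h3, homWeight, h1, ← mul_div_assoc, mul_div_right_comm]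
  push_cast
  exact mul_le_mul_of_nonneg_left (pow_le_pow_left₀ (Nat.cast_nonneg _) h2 2) (mu0_pos G).le

theorem summable_Moment (e : X0 p →₀ ℝ) : Summable (Moment p e) := by
  have : Moment p e = fun G => ∑ F ∈ e.support, e F * moment F G := funext (Moment_apply e)
  rw [this]
  exact summable_sum fun F _ => (summable_moment F).mul_left _

theorem squareSummable_Moment (e : X0 p →₀ ℝ) : SquareSummable (Moment p e) := by
  induction e using Finsupp.induction_linear with
  | zero => simp [SquareSummable]
  | add f g hf hg =>
    refine Summable.of_nonneg_of_le (fun G => div_nonneg (sq_nonneg _) (mu0_pos G).le)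
      (fun G => ?_) ((Summable.add hf hg).mul_left 2)
    rw [map_add, Pi.add_apply, ← add_div, ← mul_div_assoc]
    refine div_le_div_of_nonneg_right ?_ (mu0_pos G).le
    nlinarith [sq_nonneg (Moment p f G - Moment p g G)]
  | single F a =>
    refine ((squareSummable_moment F).mul_left (a ^ 2)).congr fun G => ?_
    rw [Moment, Finsupp.linearCombination_single, Pi.smul_apply, smul_eq_mul, mul_pow, mul_div_assoc]

end Summability

/-! ### Triangularity of δ₀ and of the moment map -/

section Triangular

variable {p : ℕ} [Fact p.Prime]

theorem X0.le_refl (F : X0 p) : F ≤ F := ⟨LinearMap.id, Function.surjective_id⟩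

theorem X0.le_trans {F₁ F₂ F₃ : X0 p} (h₁ : F₁ ≤ F₂) (h₂ : F₂ ≤ F₃) : F₁ ≤ F₃ := by
  obtain ⟨f, hf⟩ := h₁
  obtain ⟨g, hg⟩ := h₂
  exact ⟨f ∘ₗ g, hf.comp hg⟩

theorem X0.order_le_of_le {F' F : X0 p} (h : F' ≤ F) : F'.order ≤ F.order := by
  obtain ⟨f, hf⟩ := h
  exact Nat.card_le_card_of_surjective f hf

theorem X0.eq_of_surjective_of_order_le {F' F : X0 p} {f : F.rep →ₗ[ℤ_[p]] F'.rep}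
    (hf : Function.Surjective f) (h : F.order ≤ F'.order) : F' = F := by
  have hb : Function.Bijective f :=
    (Nat.bijective_iff_surjective_and_card f).2
      ⟨hf, le_antisymm h (Nat.card_le_card_of_surjective f hf)⟩
  exact (X0.ext_iff_nonempty.2 ⟨LinearEquiv.ofBijective f hb⟩).symm

theorem X0.eq_of_le_of_order_le {F' F : X0 p} (h : F' ≤ F) (ho : F.order ≤ F'.order) : F' = F := by
  obtain ⟨f, hf⟩ := h
  exact X0.eq_of_surjective_of_order_le hf ho

theorem X0.finite_le (F : X0 p) : {K : X0 p | K ≤ F}.Finite := by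
  refine ((Set.finite_Iic F.order).biUnion fun n _ => X0.finite_order_eq (p := p) n).subset ?_
  intro K hK
  exact Set.mem_biUnion (Set.mem_Iic.2 (X0.order_le_of_le hK)) rfl

theorem X0.le_of_probDelta_ne_zero {F K : X0 p} (h : probDelta F K ≠ 0) : K ≤ F := by
  have h1 : Nat.card {φ : Dual0 F // Nonempty (LinearMap.ker φ ≃ₗ[ℤ_[p]] K.rep)} ≠ 0 := by
    intro h0
    rw [probDelta, h0] at h
    simp at h
  obtain ⟨⟨φ, ⟨e⟩⟩⟩ := (Nat.card_ne_zero.1 h1).1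
  obtain ⟨θ, hθ⟩ := exists_equiv_ker_quotient p F.rep
  obtain ⟨x, rfl⟩ := θ.surjective φ
  obtain ⟨f⟩ := hθ x
  exact ⟨(f.symm.trans e).toLinearMap ∘ₗ Submodule.mkQ _,
    (f.symm.trans e).surjective.comp (Submodule.mkQ_surjective _)⟩

/-- Only the zero character has a kernel of full order. -/
theorem probDelta_self (F : X0 p) : probDelta F F = 1 / F.order := by
  have h : Nat.card {φ : Dual0 F // Nonempty (LinearMap.ker φ ≃ₗ[ℤ_[p]] F.rep)} = 1 := by
    rw [Nat.card_eq_one_iff_unique]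
    refine ⟨⟨?_⟩, ⟨⟨0, ⟨?_⟩⟩⟩⟩
    · have key : ∀ φ : Dual0 F, Nonempty (LinearMap.ker φ ≃ₗ[ℤ_[p]] F.rep) → φ = 0 := by
        rintro φ ⟨e⟩
        rw [← LinearMap.ker_eq_top]
        refine SetLike.coe_injective (Set.eq_of_subset_of_ncard_le (Set.subset_univ _) ?_
          (Set.toFinite _))
        rw [Submodule.top_coe, Set.ncard_univ]
        exact (Nat.card_congr e.toEquiv).ge
      rintro ⟨φ, hφ⟩ ⟨ψ, hψ⟩
      exact Subtype.ext ((key φ hφ).trans (key ψ hψ).symm)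
    · rw [LinearMap.ker_zero]
      exact Submodule.topEquiv
  rw [probDelta, h, card_dual, Nat.cast_one]
  rfl

theorem deltaLinear_apply_of_maximal {e : X0 p →₀ ℝ} {K : X0 p}
    (h : ∀ G ∈ e.support, G.order ≤ K.order) : deltaLinear p e K = e K * (1 / K.order) := by
  rw [deltaLinear_apply, Finset.sum_eq_single K, probDelta_self]
  · intro G hG hGK
    by_contra h0
    exact hGK (X0.eq_of_le_of_order_le
      (X0.le_of_probDelta_ne_zero (right_ne_zero_of_mul h0)) (h G hG)).symm
  · intro hK
    rw [Finsupp.notMem_support_iff.1 hK, zero_mul]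

theorem exists_mem_support_deltaLinear {e : X0 p →₀ ℝ} {K : X0 p}
    (h : deltaLinear p e K ≠ 0) : ∃ G ∈ e.support, K ≤ G := by
  rw [deltaLinear_apply] at h
  obtain ⟨G, hG, h0⟩ := Finset.exists_ne_zero_of_sum_ne_zero h
  exact ⟨G, hG, X0.le_of_probDelta_ne_zero (right_ne_zero_of_mul h0)⟩

/-- The operator `δ₀ - 1 / |F|`. -/
noncomputable def deltaSub (F : X0 p) : (X0 p →₀ ℝ) →ₗ[ℝ] (X0 p →₀ ℝ) :=
  deltaLinear p - (1 / (F.order : ℝ)) • LinearMap.id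

theorem deltaSub_apply (F : X0 p) (e : X0 p →₀ ℝ) :
    deltaSub F e = deltaLinear p e - (1 / (F.order : ℝ)) • e := rfl

theorem X0.order_lt_of_mem {F K : X0 p} (h : K ∈ {K : X0 p | K ≤ F ∧ K ≠ F}) :
    K.order < F.order :=
  lt_of_not_ge fun ho => h.2 (X0.eq_of_le_of_order_le h.1 ho)

theorem deltaSub_mem_supported {F : X0 p} {w : X0 p →₀ ℝ}
    (hw : w ∈ Finsupp.supported ℝ ℝ {K : X0 p | K ≤ F ∧ K ≠ F}) :
    deltaSub F w ∈ Finsupp.supported ℝ ℝ {K : X0 p | K ≤ F ∧ K ≠ F} := by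
  refine sub_mem ?_ (Submodule.smul_mem _ _ hw)
  rw [Finsupp.mem_supported]
  intro K hK
  obtain ⟨G, hG, hKG⟩ := exists_mem_support_deltaLinear (Finsupp.mem_support_iff.1 hK)
  have hGF := (Finsupp.mem_supported _ _).1 hw hG
  refine ⟨X0.le_trans hKG hGF.1, fun h => ?_⟩
  have h1 := X0.order_lt_of_mem hGF
  have h2 := X0.order_le_of_le hKG
  rw [h] at h2
  omega

theorem deltaSub_single_mem_supported (F : X0 p) :
    deltaSub F (Finsupp.single F 1) ∈ Finsupp.supported ℝ ℝ {K : X0 p | K ≤ F ∧ K ≠ F} := by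
  rw [Finsupp.mem_supported]
  intro K hK
  have hK : deltaSub F (Finsupp.single F 1) K ≠ 0 := Finsupp.mem_support_iff.1 hK
  rw [deltaSub_apply, Finsupp.sub_apply, deltaLinear_single_apply, Finsupp.smul_apply,
    smul_eq_mul] at hK
  have hKF : K ≠ F := by
    rintro rfl
    rw [probDelta_self, Finsupp.single_eq_same, mul_one, sub_self] at hK
    exact hK rfl
  rw [Finsupp.single_eq_of_ne hKF, mul_zero, sub_zero] at hK
  exact ⟨X0.le_of_probDelta_ne_zero hK, hKF⟩

/-- At a class K of maximal order in the support, the operator multiplies the coefficient by 1/|K| −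
1/|F|, which is nonzero because |K| < |F|. -/
theorem eq_zero_of_deltaSub_eq_zero {F : X0 p} {w : X0 p →₀ ℝ}
    (hw : w ∈ Finsupp.supported ℝ ℝ {K : X0 p | K ≤ F ∧ K ≠ F}) (h : deltaSub F w = 0) : w = 0 := by
  by_contra h0
  obtain ⟨K, hK, hmax⟩ := Finset.exists_max_image w.support X0.order (Finsupp.support_nonempty_iff.2 h0)
  have h1 := DFunLike.congr_fun h K
  rw [deltaSub_apply, Finsupp.sub_apply, deltaLinear_apply_of_maximal hmax, Finsupp.smul_apply,
    smul_eq_mul, mul_comm, ← sub_mul, Finsupp.zero_apply] at h1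
  have h2 := (mul_eq_zero.1 h1).resolve_right (Finsupp.mem_support_iff.1 hK)
  have hlt := X0.order_lt_of_mem ((Finsupp.mem_supported _ _).1 hw hK)
  have hpos : (0 : ℝ) < K.order := by exact_mod_cast K.order_pos
  have := one_div_lt_one_div_of_lt hpos (Nat.cast_lt.2 hlt)
  linarith

/-- An endomorphism that is injective on a finite-dimensional invariant subspace is surjective
there. -/
theorem LinearMap.exists_mem_apply_eq_of_injOn {E : Type*} [AddCommGroup E] [Module ℝ E]
    {V : Submodule ℝ E} [FiniteDimensional ℝ V] {f : E →ₗ[ℝ] E} (hf : ∀ w ∈ V, f w ∈ V)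
    (hinj : ∀ w ∈ V, f w = 0 → w = 0) {y : E} (hy : y ∈ V) : ∃ w ∈ V, f w = y := by
  have h : Function.Injective (f.restrict hf) := by
    rw [← LinearMap.ker_eq_bot, LinearMap.ker_eq_bot']
    intro w hw
    exact Subtype.ext (hinj w w.2 (congrArg Subtype.val hw))
  obtain ⟨w, hw⟩ := LinearMap.surjective_of_injective h ⟨y, hy⟩
  exact ⟨w, w.2, congrArg Subtype.val hw⟩

/-- The eigenfunctions of `δ₀`. -/
theorem exists_deltaLinear_eigenvector (F : X0 p) :
    ∃ e : X0 p →₀ ℝ, e F = 1 ∧ (∀ K ∈ e.support, K ≤ F) ∧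
      deltaLinear p e = (1 / (F.order : ℝ)) • e := by
  let s := {K : X0 p | K ≤ F ∧ K ≠ F}
  have hs : Finite s := (X0.finite_le F).subset fun K hK => hK.1
  have : FiniteDimensional ℝ (Finsupp.supported ℝ ℝ s) :=
    Module.Finite.equiv (Finsupp.supportedEquivFinsupp s).symm
  -- On the span of the classes strictly below F, δ₀ − 1/|F| is invertible, and it maps the point
  -- mass at F into this span. Solving for `w` corrects the point mass to an eigenvector.
  obtain ⟨w, hw, hfw⟩ := LinearMap.exists_mem_apply_eq_of_injOn (f := deltaSub F)
    (fun w hw => deltaSub_mem_supported hw) (fun w hw => eq_zero_of_deltaSub_eq_zero hw)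
    (deltaSub_single_mem_supported F)
  have hwF : w F = 0 := by
    by_contra h
    exact ((Finsupp.mem_supported _ _).1 hw (Finsupp.mem_support_iff.2 h)).2 rfl
  refine ⟨Finsupp.single F 1 - w, ?_, ?_, ?_⟩
  · rw [Finsupp.sub_apply, Finsupp.single_eq_same, hwF, sub_zero]
  · intro K hK
    by_cases hKF : K = F
    · exact hKF ▸ X0.le_refl F
    · rw [Finsupp.mem_support_iff, Finsupp.sub_apply, Finsupp.single_eq_of_ne hKF, zero_sub,
        neg_ne_zero] at hK
      exact ((Finsupp.mem_supported _ _).1 hw (Finsupp.mem_support_iff.2 hK)).1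
  · have h : deltaSub F (Finsupp.single F 1 - w) = 0 := by rw [map_sub, hfw, sub_self]
    rw [deltaSub_apply] at h
    exact sub_eq_zero.1 h

theorem numSur_self (F : X0 p) : F.numSur F ≠ 0 := by
  have : Nonempty {f : F.rep →ₗ[ℤ_[p]] F.rep // Function.Surjective f} :=
    ⟨⟨LinearMap.id, Function.surjective_id⟩⟩
  exact Nat.card_pos.ne'

theorem numSur_eq_zero {G F : X0 p} (h : G.order ≤ F.order) (hne : F ≠ G) : G.numSur F = 0 := by
  by_contra h0
  obtain ⟨⟨f, hf⟩⟩ := (Nat.card_ne_zero.1 h0).1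
  exact hne (X0.eq_of_surjective_of_order_le hf h)

/-- At a class of minimal order in the support of `e`, only the moment of that class itself
survives. -/
theorem ker_Moment (p : ℕ) [Fact p.Prime] : LinearMap.ker (Moment p) = ⊥ := by
  rw [LinearMap.ker_eq_bot']
  intro e he
  by_contra h0
  obtain ⟨G, hG, hmin⟩ := Finset.exists_min_image e.support X0.order
    (Finsupp.support_nonempty_iff.2 h0)
  have h1 := congrFun he G
  rw [Moment_apply, Finset.sum_eq_single_of_mem G hG fun F hF hFG => by
    rw [moment, numSur_eq_zero (hmin F hF) hFG, Nat.cast_zero, zero_mul, mul_zero]] at h1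
  exact mul_ne_zero (Finsupp.mem_support_iff.1 hG)
    (mul_ne_zero (Nat.cast_ne_zero.2 (numSur_self G)) (mu0_pos G).ne') h1

/-- In a vanishing combination, evaluation at an index of maximal order isolates its coefficient. -/
theorem linearIndependent_of_unitriangular {e : X0 p → (X0 p →₀ ℝ)} (h1 : ∀ F, e F F = 1)
    (hle : ∀ F, ∀ K ∈ (e F).support, K ≤ F) : LinearIndependent ℝ e := by
  rw [linearIndependent_iff]
  intro l hl
  by_contra h0
  obtain ⟨F, hF, hmax⟩ := Finset.exists_max_image l.support X0.order
    (Finsupp.support_nonempty_iff.2 h0)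
  have h2 := DFunLike.congr_fun hl F
  rw [Finsupp.linearCombination_apply, Finsupp.sum, Finsupp.finsetSum_apply,
    Finset.sum_eq_single_of_mem F hF fun F' hF' hne => by
      have : e F' F = 0 := by
        by_contra h
        exact hne (X0.eq_of_le_of_order_le (hle F' F (Finsupp.mem_support_iff.2 h))
          (hmax F' hF')).symm
      rw [Finsupp.smul_apply, this, smul_zero],
    Finsupp.smul_apply, h1, smul_eq_mul, mul_one] at h2
  exact Finsupp.mem_support_iff.1 hF h2

end Triangular

theorem mainTheorem7 (p : ℕ) [Fact p.Prime] :
    ∃ e : X0 p → (X0 p →₀ ℝ),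
      (∀ F : X0 p,
        -- `e F` is `1_F` plus a combination of the `1_{F'}` with `F' < F`
        e F F = 1 ∧ (∀ F' ∈ (e F).support, F' ≤ F) ∧
        -- `e F` is an eigenfunction of `δ₀`
        delta0 (e F) = (1 / (F.order : ℝ)) • ⇑(e F) ∧
        -- `E_F = Moment (e F)` is an eigenfunction of `Δ₀`, and square-summable
        IsEigenfunctionDelta0 (Moment p (e F)) (1 / (F.order : ℝ)) ∧
        SquareSummable (Moment p (e F))) ∧
      LinearIndependent ℝ (fun F : X0 p => Moment p (e F)) := by
  choose e h1 hle he using exists_deltaLinear_eigenvector (p := p)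
  -- Independence also supplies the nonvanishing of each eigenfunction.
  have hind := (linearIndependent_of_unitriangular h1 hle).map' (Moment p) (ker_Moment p)
  refine ⟨e, fun F => ⟨h1 F, hle F, ?_, ⟨summable_Moment _, hind.ne_zero F, ?_⟩,
    squareSummable_Moment _⟩, hind⟩
  · rw [← coe_deltaLinear, he]
    rfl
  · rw [Delta0_Moment, he, map_smul]
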